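/- Let $\mathbb T$ be the 3-regular tree with root $\varnothing$ and graph distance $d$. A line is the trace $\{x_n, n\in\mathbb Z\}$ of a bi-infinite geodesic path ($d(x_m,x_n)=|m-n|$ for all $m,n$), and $\mathbb L$ is the space of lines, with the final topology with respect to the map $\Lambda$ sending a pair of distinct rays from $\varnothing$ to the line with these two endpoints, and with its Borel $\sigma$-algebra. Let $\mu$ be the automorphism-invariant, locally finite Borel measure on $\mathbb L$ normalised so that $\mu\{\ell : x,y\in\ell\}=2^{-d(x,y)}$ for all $x\neq y$ in $\mathbb T$; explicitly, $\int\varphi\,\mathrm d\mu=\tfrac98\,\mathbb E\big[\varphi(\Lambda(X,Y))\,4^{|X\wedge Y|}\big]$ for Borel $\varphi\ge0$, where $X,Y$ are independent non-backtracking random walks from $\varnothing$ and $|X\wedge Y|$ is the distance from $\varnothing$ to the last vertex common to the two paths. Let $\beta>2$, and let $\Pi$ be a Poisson process on $\mathbb L\times(0,\infty)$ with intensity measure $(\beta-1)\,\mu\otimes v^{-\beta}\mathrm dv$. For an edge $e$ of $\mathbb T$, let $V_e=\sup\{v : (\ell,v)\in\Pi,\ \ell \text{ passes through } e\}$ be the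 speed of the fastest road through $e$ (with $\sup\emptyset=0$), and for vertices $x,y$ let $T(x,y)=\sum_e V_e^{-1}\in[0,\infty]$, where the sum is over the edges $e$ of the geodesic path between $x$ and $y$. Then there exists $t>0$, depending only on $\beta$, such that $\#\{x\in\mathbb T : T(\varnothing,x)\le t\}$ is a random variable with $$\mathbb E\big[\#\{x\in\mathbb T : T(\varnothing,x)\le t\}\big]\le 2<\infty .$$ Moreover there is no explosion: almost surely, for every infinite geodesic path $(\varnothing=x_0,x_1,x_2,\ldots)$ in $\mathbb T$, $\sum_{n\ge1}T(x_{n-1},x_n)=\infty$. -/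

import Mathlib

open MeasureTheory ProbabilityTheory
open scoped ENNReal NNReal

namespace TreeRoads

/-! ## The 3-regular tree -/

/-- Vertices of the 3-regular tree: the root is `none`; a non-root vertex is `some (i, w)`, where
`i` is the label of its first step away from the root (3 choices) and `w` is the list of the
labels of the later steps (2 choices each), the most recent one first. -/
abbrev Vertex : Type := Option (Fin 3 × List (Fin 2))

/-- The root. -/
abbrev root : Vertex := none

/-- The neighbour that is closer to the root (the root itself, for the root). -/
def parent : Vertex → Vertex
  | none => none
  | some (_, []) => none
  | some (i, _ :: w) => some (i, w)

/-- The 3-regular tree: `x` and `y` are adjacent iff they are distinct and one is the parent of the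
other. Its graph distance is `tree.dist`. -/
def tree : SimpleGraph Vertex := SimpleGraph.fromRel (fun x y => parent x = y)

/-- Distance to the root. -/
def depth : Vertex → ℕ
  | none => 0
  | some (_, w) => w.length + 1

theorem tree_adj {x y : Vertex} : tree.Adj x y ↔ x ≠ y ∧ (parent x = y ∨ parent y = x) := by
  simp [tree]

theorem depth_parent (x : Vertex) : depth (parent x) = depth x - 1 := by
  rcases x with _ | ⟨i, _ | ⟨a, w⟩⟩ <;> simp [parent, depth]

theorem depth_pos {x : Vertex} (h : x ≠ root) : 0 < depth x := by
  rcases x with _ | ⟨i, w⟩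
  · exact absurd rfl h
  · simp [depth]

theorem adj_parent {x : Vertex} (h : x ≠ root) : tree.Adj x (parent x) := by
  refine tree_adj.2 ⟨fun e => ?_, Or.inl rfl⟩
  have h1 := depth_parent x
  have h2 := depth_pos h
  rw [← e] at h1
  omega

/-- `Under c x`: the vertex `x` lies in the subtree of the descendants of `c`. -/
def Under (c x : Vertex) : Prop := ∃ j : ℕ, parent^[j] x = c

theorem depth_iterate (j : ℕ) (x : Vertex) : depth (parent^[j] x) = depth x - j := by
  induction j with
  | zero => simp
  | succ j ih => rw [Function.iterate_succ_apply', depth_parent, ih]; omega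

theorem Under.depth_le {c x : Vertex} (h : Under c x) : depth c ≤ depth x := by
  obtain ⟨j, rfl⟩ := h
  rw [depth_iterate]
  omega

theorem under_of_parent {c x : Vertex} (h : Under c (parent x)) : Under c x := by
  obtain ⟨j, hj⟩ := h
  exact ⟨j + 1, by rwa [Function.iterate_succ_apply]⟩

theorem Under.parent_of_ne {c x : Vertex} (h : Under c x) (hx : x ≠ c) : Under c (parent x) := by
  obtain ⟨j, hj⟩ := h
  rcases j with _ | j
  · exact absurd hj hx
  · exact ⟨j, by rwa [Function.iterate_succ_apply] at hj⟩

theorem tree_connected : tree.Connected := by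
  have key : ∀ n : ℕ, ∀ x : Vertex, depth x = n → tree.Reachable x root := by
    intro n
    induction n with
    | zero =>
      intro x hx
      by_cases h : x = root
      · rw [h]
      · have := depth_pos h; omega
    | succ n ih =>
      intro x hx
      have h : x ≠ root := by rintro rfl; simp [depth] at hx
      exact (adj_parent h).reachable.trans (ih _ (by rw [depth_parent, hx]; rfl))
  exact ⟨fun x y => (key _ x rfl).trans (key _ y rfl).symm⟩

/-- The graph `tree` is a tree. -/
theorem tree_isTree : tree.IsTree := by
  refine ⟨tree_connected, ?_⟩
  have key : ∀ x y : Vertex, x ≠ y → parent x = y → tree.IsBridge s(x, y) := by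
    intro x y hne hp
    rw [SimpleGraph.isBridge_iff]
    intro hr
    have hstep : ∀ u v : Vertex, (tree.deleteEdges {s(x, y)}).Adj u v → Under x u → Under x v := by
      intro u v huv hu
      rw [SimpleGraph.deleteEdges_adj] at huv
      obtain ⟨hadj, hnot⟩ := huv
      rcases (tree_adj.1 hadj).2 with h | h
      · rw [← h]
        refine hu.parent_of_ne ?_
        rintro rfl
        apply hnot
        rw [← h, ← hp]
        rfl
      · exact under_of_parent (h ▸ hu)
    have hU : Under x y := by
      obtain ⟨p⟩ := hr
      have : ∀ (u v : Vertex) (q : (tree.deleteEdges {s(x, y)}).Walk u v), Under x u → Under x v := by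
        intro u v q
        induction q with
        | nil => exact id
        | cons h _ ih => exact fun hu => ih (hstep _ _ h hu)
      exact this _ _ p ⟨0, rfl⟩
    have h1 := hU.depth_le
    have hx : x ≠ root := by
      rintro rfl
      exact hne hp
    have h2 := depth_pos hx
    have h3 := depth_parent x
    rw [hp] at h3
    omega
  rw [SimpleGraph.isAcyclic_iff_forall_adj_isBridge]
  intro x y hxy
  obtain ⟨hne, h | h⟩ := tree_adj.1 hxy
  · exact key x y hne h
  · rw [Sym2.eq_swap]
    exact key y x hne.symm h

/-- Every vertex of `tree` has exactly three neighbours. -/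
theorem tree_regular (x : Vertex) : (tree.neighborSet x).encard = 3 := by
  rcases x with _ | ⟨i, w⟩
  · have : tree.neighborSet none = {some (0, []), some (1, []), some (2, [])} := by
      ext y
      rw [SimpleGraph.mem_neighborSet, tree_adj]
      rcases y with _ | ⟨j, _ | ⟨a, w⟩⟩
      · simp
      · fin_cases j <;> simp [parent]
      · simp [parent]
    rw [this, Set.encard_insert_of_notMem (by simp), Set.encard_pair (by simp)]
    norm_num
  · have : tree.neighborSet (some (i, w)) =
        {parent (some (i, w)), some (i, 0 :: w), some (i, 1 :: w)} := by
      ext y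
      rw [SimpleGraph.mem_neighborSet, tree_adj]
      constructor
      · rintro ⟨hne, h | h⟩
        · exact Or.inl h.symm
        · right
          rcases y with _ | ⟨j, _ | ⟨a, v⟩⟩
          · simp [parent] at h
          · simp [parent] at h
          · simp only [parent, Option.some.injEq, Prod.mk.injEq] at h
            obtain ⟨rfl, rfl⟩ := h
            fin_cases a <;> simp
      · rintro (rfl | rfl | rfl)
        · exact tree_adj.1 (adj_parent (by simp))
        · exact ⟨by simp, Or.inr rfl⟩
        · exact ⟨by simp, Or.inr rfl⟩
    rw [this, Set.encard_insert_of_notMem, Set.encard_pair (by simp)]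
    · norm_num
    · intro h
      have h1 := depth_parent (some (i, w))
      rcases h with h | h
      · rw [h] at h1; simp only [depth, List.length_cons] at h1; omega
      · rw [Set.mem_singleton_iff] at h
        rw [h] at h1; simp only [depth, List.length_cons] at h1; omega

/-! ## Rays and lines -/

/-- A ray (an infinite non-backtracking path from the root), coded by the label of its first step
and the labels of its later steps. The product topology is that of the metric `rayDist`. -/
abbrev Ray : Type := Fin 3 × (ℕ → Fin 2)

/-- The first `n` letters of a sequence, the last one first. -/
def revPrefix (b : ℕ → Fin 2) : ℕ → List (Fin 2)
  | 0 => []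
  | n + 1 => b n :: revPrefix b n

/-- The vertex of a ray at distance `n` from the root. -/
def Ray.vertex (ξ : Ray) : ℕ → Vertex
  | 0 => root
  | n + 1 => some (ξ.1, revPrefix ξ.2 n)

/-- For `ξ ≠ η`, the distance to the root of the farthest vertex `ξ ∧ η` that is common to the two
rays, i.e. the least `n` such that their vertices at distance `n + 1` from the root differ. -/
noncomputable def meetDepth (ξ η : Ray) : ℕ := sInf {n | ξ.vertex (n + 1) ≠ η.vertex (n + 1)}

open Classical in
/-- The metric `d(ξ, η) = 2 ^ (-|ξ ∧ η|)` on the space of rays. -/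
noncomputable def rayDist (ξ η : Ray) : ℝ := if ξ = η then 0 else (2 : ℝ)⁻¹ ^ meetDepth ξ η

/-- The bi-infinite sequence `…, x_{n+1}, ξ ∧ η, y_{n+1}, …`, where `n = |ξ ∧ η|`, `x_k` are the
vertices of `ξ` and `y_k` those of `η`; the vertex `ξ ∧ η` has index `0`. -/
noncomputable def joinPath (ξ η : Ray) (k : ℤ) : Vertex :=
  if 0 ≤ k then η.vertex (meetDepth ξ η + k.natAbs) else ξ.vertex (meetDepth ξ η + k.natAbs)

/-- A line is the trace of a bi-infinite geodesic path. -/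
def IsLine (ℓ : Set Vertex) : Prop :=
  ∃ x : ℤ → Vertex, (∀ m n : ℤ, (tree.dist (x m) (x n) : ℤ) = |m - n|) ∧ ℓ = Set.range x

/-- The space of lines. -/
def Line : Type := {ℓ : Set Vertex // IsLine ℓ}

instance : Membership Vertex Line := ⟨fun ℓ x => x ∈ ℓ.1⟩

theorem parent_vertex (ξ : Ray) (n : ℕ) : parent (ξ.vertex (n + 1)) = ξ.vertex n := by
  cases n <;> rfl

theorem length_revPrefix (b : ℕ → Fin 2) (n : ℕ) : (revPrefix b n).length = n := by
  induction n with
  | zero => rfl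
  | succ n ih => simp [revPrefix, ih]

theorem depth_vertex (ξ : Ray) (n : ℕ) : depth (ξ.vertex n) = n := by
  cases n with
  | zero => rfl
  | succ n => simp [Ray.vertex, depth, length_revPrefix]

theorem iterate_vertex (ξ : Ray) (j n : ℕ) : parent^[j] (ξ.vertex (n + j)) = ξ.vertex n := by
  induction j with
  | zero => rfl
  | succ j ih => rw [Function.iterate_succ_apply, ← add_assoc, parent_vertex, ih]

theorem under_vertex {ξ : Ray} {m n : ℕ} (h : m ≤ n) : Under (ξ.vertex m) (ξ.vertex n) := by
  obtain ⟨j, rfl⟩ := Nat.exists_eq_add_of_le h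
  exact ⟨j, iterate_vertex ξ j m⟩

theorem eq_of_under_vertex {c : Vertex} {ξ : Ray} {n : ℕ} (hc : c ≠ root)
    (h : Under c (ξ.vertex n)) : c = ξ.vertex (depth c) := by
  obtain ⟨j, rfl⟩ := h
  have h1 := depth_pos hc
  rw [depth_iterate, depth_vertex] at *
  obtain ⟨k, rfl⟩ := Nat.exists_eq_add_of_le' (show j ≤ n by omega)
  rw [iterate_vertex, Nat.add_sub_cancel]

theorem vertex_succ_ne_root (ξ : Ray) (n : ℕ) : ξ.vertex (n + 1) ≠ root := by simp [Ray.vertex]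

theorem adj_vertex (ξ : Ray) (n : ℕ) : tree.Adj (ξ.vertex (n + 1)) (ξ.vertex n) := by
  have := adj_parent (vertex_succ_ne_root ξ n)
  rwa [parent_vertex] at this

theorem exists_vertex_ne {ξ η : Ray} (h : ξ ≠ η) : ∃ n, ξ.vertex (n + 1) ≠ η.vertex (n + 1) := by
  by_contra! H
  apply h
  have h0 := H 0
  simp only [Ray.vertex, Option.some.injEq, Prod.mk.injEq] at h0
  refine Prod.ext h0.1 (funext fun n => ?_)
  have hn := H (n + 1)
  simp only [Ray.vertex, revPrefix, Option.some.injEq, Prod.mk.injEq, List.cons.injEq] at hn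
  exact hn.2.1

theorem vertex_meetDepth_ne {ξ η : Ray} (h : ξ ≠ η) :
    ξ.vertex (meetDepth ξ η + 1) ≠ η.vertex (meetDepth ξ η + 1) :=
  Nat.sInf_mem (s := {n | ξ.vertex (n + 1) ≠ η.vertex (n + 1)}) (exists_vertex_ne h)

theorem vertex_meetDepth_eq (ξ η : Ray) :
    ξ.vertex (meetDepth ξ η) = η.vertex (meetDepth ξ η) := by
  rcases hm : meetDepth ξ η with _ | n
  · rfl
  · by_contra hne
    have : meetDepth ξ η ≤ n := Nat.sInf_le (s := {n | ξ.vertex (n + 1) ≠ η.vertex (n + 1)}) hne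
    omega

theorem joinPath_adj (ξ η : Ray) (k : ℤ) : tree.Adj (joinPath ξ η k) (joinPath ξ η (k + 1)) := by
  rcases le_or_gt 0 k with hk | hk
  · obtain ⟨j, rfl⟩ := Int.eq_ofNat_of_zero_le hk
    rw [joinPath, joinPath, if_pos hk, if_pos (by omega)]
    exact (adj_vertex η _).symm
  · obtain ⟨j, rfl⟩ := Int.eq_negSucc_of_lt_zero hk
    rw [joinPath, if_neg (by omega)]
    rcases j with _ | j
    · have : joinPath ξ η (Int.negSucc 0 + 1) = ξ.vertex (meetDepth ξ η) := by
        rw [vertex_meetDepth_eq]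
        simp [joinPath]
      rw [this]
      exact adj_vertex ξ _
    · have h1 : Int.negSucc (j + 1) + 1 = Int.negSucc j := by omega
      rw [joinPath, h1, if_neg (by omega)]
      exact adj_vertex ξ _

open Classical in
/-- A signed distance to the vertex `ξ ∧ η`, measured along the two branches. -/
noncomputable def height (ξ η : Ray) (x : Vertex) : ℤ :=
  if Under (η.vertex (meetDepth ξ η + 1)) x then (depth x : ℤ) - meetDepth ξ η
  else if Under (ξ.vertex (meetDepth ξ η + 1)) x then (meetDepth ξ η : ℤ) - depth x
  else 0

theorem height_parent (ξ η : Ray) {x : Vertex} (hx : x ≠ root) :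
    |height ξ η x - height ξ η (parent x)| ≤ 1 := by
  have hd := depth_parent x
  have hp := depth_pos hx
  have down : ∀ {ζ : Ray} {k : ℕ}, Under (ζ.vertex (k + 1)) (parent x) →
      Under (ζ.vertex (k + 1)) x := fun h => under_of_parent h
  have up : ∀ {ζ : Ray} {k : ℕ}, Under (ζ.vertex (k + 1)) x →
      ¬ Under (ζ.vertex (k + 1)) (parent x) → depth x = k + 1 := by
    intro ζ k h h'
    have : x = ζ.vertex (k + 1) := by
      by_contra hne
      exact h' (h.parent_of_ne hne)
    rw [this, depth_vertex]
  have low : ∀ {ζ : Ray} {k : ℕ}, Under (ζ.vertex (k + 1)) (parent x) →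
      k + 1 ≤ depth (parent x) := by
    intro ζ k h
    have := h.depth_le
    rwa [depth_vertex] at this
  rw [abs_le]
  unfold height
  by_cases a : Under (η.vertex (meetDepth ξ η + 1)) x <;>
  by_cases b : Under (ξ.vertex (meetDepth ξ η + 1)) x <;>
  by_cases a' : Under (η.vertex (meetDepth ξ η + 1)) (parent x) <;>
  by_cases b' : Under (ξ.vertex (meetDepth ξ η + 1)) (parent x) <;>
  simp only [a, b, a', b', if_true, if_false] <;>
  first
    | exact absurd (down a') a
    | exact absurd (down b') b
    | (have h1 := up a a'; have h2 := low b'; omega)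
    | (have h1 := up a a'; omega)
    | (have h1 := up b b'; omega)
    | omega

theorem abs_height_sub_le_dist (ξ η : Ray) (x y : Vertex) :
    |height ξ η x - height ξ η y| ≤ tree.dist x y := by
  have hadj : ∀ u v : Vertex, tree.Adj u v → |height ξ η u - height ξ η v| ≤ 1 := by
    intro u v huv
    obtain ⟨hne, h | h⟩ := tree_adj.1 huv
    · have hu : u ≠ root := by rintro rfl; exact hne h
      rw [← h]
      exact height_parent ξ η hu
    · have hv : v ≠ root := by rintro rfl; exact hne h.symm
      rw [← h, abs_sub_comm]
      exact height_parent ξ η hv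
  obtain ⟨p, hp⟩ := tree_connected.exists_walk_length_eq_dist x y
  rw [← hp]
  clear hp
  induction p with
  | nil => simp
  | @cons u v w h q ih =>
    have h1 := hadj _ _ h
    have h2 := abs_sub_le (height ξ η u) (height ξ η v) (height ξ η w)
    refine h2.trans ((add_le_add h1 ih).trans ?_)
    rw [SimpleGraph.Walk.length_cons]
    push_cast
    omega

theorem height_joinPath {ξ η : Ray} (h : ξ ≠ η) (k : ℤ) : height ξ η (joinPath ξ η k) = k := by
  have hne := vertex_meetDepth_ne h
  rcases le_or_gt 0 k with hk | hk
  · rw [joinPath, if_pos hk, height, depth_vertex]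
    split_ifs with h1 h2
    · omega
    · exact absurd ((eq_of_under_vertex (vertex_succ_ne_root _ _) h2).trans
        (by rw [depth_vertex])) hne
    · by_contra h0
      exact h1 (under_vertex (by omega))
  · rw [joinPath, if_neg (by omega), height, depth_vertex]
    split_ifs with h1 h2
    · exact absurd ((eq_of_under_vertex (vertex_succ_ne_root _ _) h1).trans
        (by rw [depth_vertex])).symm hne
    · omega
    · exact absurd (under_vertex (by omega)) h2

theorem dist_joinPath {ξ η : Ray} (h : ξ ≠ η) (m n : ℤ) :
    (tree.dist (joinPath ξ η m) (joinPath ξ η n) : ℤ) = |m - n| := by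
  have hle : ∀ (m : ℤ) (j : ℕ), tree.dist (joinPath ξ η m) (joinPath ξ η (m + j)) ≤ j := by
    intro m j
    induction j with
    | zero => simp
    | succ j ih =>
      have h1 := tree_connected.dist_triangle (u := joinPath ξ η m)
        (v := joinPath ξ η (m + j)) (w := joinPath ξ η (m + (j + 1 : ℕ)))
      have h2 := SimpleGraph.dist_eq_one_iff_adj.2 (joinPath_adj ξ η (m + j))
      rw [show m + ((j + 1 : ℕ) : ℤ) = m + j + 1 by push_cast; ring] at *
      omega
  apply le_antisymm
  · rcases le_total m n with hmn | hmn
    · obtain ⟨j, rfl⟩ := Int.le.dest hmn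
      have := hle m j
      rw [abs_sub_comm, add_sub_cancel_left, Nat.abs_cast]
      exact_mod_cast this
    · obtain ⟨j, rfl⟩ := Int.le.dest hmn
      have := hle n j
      rw [SimpleGraph.dist_comm, add_sub_cancel_left, Nat.abs_cast]
      exact_mod_cast this
  · have := abs_height_sub_le_dist ξ η (joinPath ξ η m) (joinPath ξ η n)
    rwa [height_joinPath h, height_joinPath h] at this

/-- The line with endpoints two distinct rays. -/
noncomputable def lineOf (p : {p : Ray × Ray // p.1 ≠ p.2}) : Line :=
  ⟨Set.range (joinPath p.1.1 p.1.2), joinPath p.1.1 p.1.2, dist_joinPath p.2, rfl⟩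

/-- The final topology with respect to the map from pairs of distinct rays to lines. -/
noncomputable instance : TopologicalSpace Line := TopologicalSpace.coinduced lineOf inferInstance

/-- The Borel `σ`-algebra of the space of lines. -/
noncomputable instance : MeasurableSpace Line := borel Line

instance : BorelSpace Line := ⟨rfl⟩

/-! ## The invariant measure on lines and the Poisson process of roads -/

/-- The law of the non-backtracking random walk from the root: the first step is uniform among the
three neighbours, and each later step is uniform among the two that do not backtrack. -/
noncomputable def rayMeasure : Measure Ray :=
  (uniformOn (Set.univ : Set (Fin 3))).prod
    (Measure.infinitePi fun _ : ℕ => uniformOn (Set.univ : Set (Fin 2)))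

/-- The automorphism-invariant measure `μ` on lines, i.e. `∫ φ dμ = (9/8) E[φ(Λ(X, Y)) / d(X, Y)²]`
for independent non-backtracking random walks `X`, `Y` from the root, where `Λ(X, Y)` is the line
with endpoints `X` and `Y`. The factor `9/8` makes the mass of the set of the lines through two
distinct vertices `x`, `y` equal to `2 ^ (-d(x, y))`. -/
noncomputable def lineMeasure : Measure Line :=
  ((9 : ℝ≥0∞) / 8) • Measure.map lineOf (Measure.comap Subtype.val
    ((rayMeasure.prod rayMeasure).withDensity
      fun p => ENNReal.ofReal (1 / rayDist p.1 p.2 ^ 2)))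

/-- A road: a line together with its speed limit `v > 0`. -/
abbrev Road : Type := Line × Set.Ioi (0 : ℝ)

/-- The intensity measure `(β - 1) μ ⊗ v ^ (-β) dv` on roads. -/
noncomputable def roadIntensity (β : ℝ) : Measure Road :=
  ENNReal.ofReal (β - 1) • lineMeasure.prod
    ((Measure.comap Subtype.val (volume : Measure ℝ)).withDensity
      fun v : Set.Ioi (0 : ℝ) => ENNReal.ofReal ((v : ℝ) ^ (-β)))

/-- An atomic measure: a finite or countable sum of Dirac masses. -/
def IsAtomic {S : Type*} [MeasurableSpace S] (π : Measure S) : Prop :=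
  ∃ (n : ℕ∞) (s : {k : ℕ // (k : ℕ∞) < n} → S), π = Measure.sum fun k => Measure.dirac (s k)

/-- `N` is a Poisson process on `S` with intensity measure `ν`, under the probability `P`: a random
atomic measure such that `N(B)` has the Poisson distribution of parameter `ν(B)` (which is the Dirac
mass at `∞` if `ν(B) = ∞`), and such that the counts of disjoint sets are independent. -/
structure IsPoissonProcess {Ω S : Type*} [MeasurableSpace Ω] [MeasurableSpace S]
    (P : Measure Ω) (ν : Measure S) (N : Ω → Measure S) : Prop where
  measurable : Measurable N
  atomic : ∀ ω, IsAtomic (N ω)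
  law_of_ne_top : ∀ B : Set S, MeasurableSet B → ν B ≠ ∞ →
    P.map (fun ω => N ω B) = (poissonMeasure (ν B).toNNReal).map (fun k : ℕ => (k : ℝ≥0∞))
  law_of_eq_top : ∀ B : Set S, MeasurableSet B → ν B = ∞ → ∀ᵐ ω ∂P, N ω B = ∞
  indep : ∀ (m : ℕ) (B : Fin m → Set S), (∀ i, MeasurableSet (B i)) →
    Pairwise (Function.onFun Disjoint B) → iIndepFun (fun i ω => N ω (B i)) P

/-! ## The driving distance -/

/-- The speed of the fastest road (atom of `π`) that passes through both `x` and `y`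
(`0` if there is none). -/
noncomputable def speed (π : Measure Road) (x y : Vertex) : ℝ≥0∞ :=
  ⨆ (r : Road) (_ : π {r} ≠ 0) (_ : x ∈ r.1 ∧ y ∈ r.1), ENNReal.ofReal (r.2 : ℝ)

/-- The geodesic path between two vertices, i.e. the unique path between them. -/
noncomputable def geodesic (x y : Vertex) : tree.Walk x y :=
  (tree_isTree.existsUnique_path x y).choose

/-- The driving distance: the sum of the passage times `1 / speed` of the edges on the geodesic
path between `x` and `y`. -/
noncomputable def drivingDist (π : Measure Road) (x y : Vertex) : ℝ≥0∞ :=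
  ((geodesic x y).darts.map fun e => (speed π e.fst e.snd)⁻¹).sum

/-- The vertices within driving distance `t` of the root. -/
def drivingBall (π : Measure Road) (t : ℝ) : Set Vertex :=
  {x | drivingDist π root x ≤ ENNReal.ofReal t}

/-- An infinite geodesic path from the root. -/
def IsGeodesicRay (x : ℕ → Vertex) : Prop :=
  x 0 = root ∧ ∀ m n : ℕ, (tree.dist (x m) (x n) : ℤ) = |(m : ℤ) - n|

end TreeRoads

open TreeRoads

namespace TreeRoads

/-! ## Coverings of a path by intervals with levels -/

/-! There are about `2 ^ n` downward paths of length `n`, so it suffices to show that a given one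
has passage time at most `t` with probability at most `2⁻¹ ^ n * u n`, where the sum of `u (n + 1)`
is small.

A line meets the path in an interval. The roads through both ends of an interval of length `l` with
speed at least `2 ^ k / (2 * t)` have intensity at most `δ * 2⁻¹ ^ l * q ^ k`, where `q = 2 ^ (1 -
β)` and `δ` is small when `t` is small. Sort the roads into disjoint classes by interval and dyadic
speed level: the events that a class is occupied are independent. If the passage time is at most
`t`, every edge is covered by an occupied class, and at most `2 ^ k` edges have only covers of level
at most `k` (`fastCover_of_pathTime_le`). The rest is a statement about random coverings.

A plain union bound over coverings fails: each starting interval has weight of order `δ` after the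
factor `2⁻¹ ^ l` is removed, and the sum of this over all lengths `l` diverges. The bound on slow
edges cures this. `FastCover.exists_first` cuts off an initial piece of length `l`, contained in one
interval of level `k`, such that either `l ≤ 2 * 2 ^ k` or half of the piece is covered by intervals
strictly inside it. The second alternative has exponentially small probability
(`measure_innerEdges_le`); the first contributes about `(2 * q) ^ k` after summation over `l`, which
is summable over `k` exactly when `q < 1 / 2`, that is, when `β > 2`. Iteration of the cut, with
independence at each step, dominates `u` by a renewal sequence with total weight `O(δ)`
(`measure_fastCover_le`, `tsum_renewal_le`).

Summation over vertices bounds the expected size of the ball. For explosion, the same sum for paths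
that start at depth `d` is finite, so by Borel–Cantelli almost surely only finitely many vertices
are reached from their ancestor at depth `d` within time `t`. A ray of finite total time would have
a tail of time less than `t`, and so infinitely many such vertices for some `d`. -/

/-- The interval class `c = (i, j, k)` covers the edges `i, …, j - 1`. -/
def Covers {n : ℕ} (c : Fin n × Fin n × Fin n) (e : ℕ) : Prop :=
  (c.1 : ℕ) ≤ e ∧ e < c.2.1

open Classical in
/-- The edges `s ≤ e < n` all of whose covering intervals in `S` have level at most `k`. -/
noncomputable def slowEdges {N : ℕ} (S : Set (Fin N × Fin N × Fin N)) (s n k : ℕ) : Finset ℕ :=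
  (Finset.Ico s n).filter fun e => ∀ c ∈ S, Covers c e → (c.2.2 : ℕ) ≤ k

/-- The edges `s ≤ e < n` are covered by `S`, and at most `2 ^ k` of them have only covering
intervals of level at most `k`. -/
def FastCover {N : ℕ} (S : Set (Fin N × Fin N × Fin N)) (s n : ℕ) : Prop :=
  (∀ e, s ≤ e → e < n → ∃ c ∈ S, Covers c e) ∧ ∀ k, (slowEdges S s n k).card ≤ 2 ^ k

open Classical in
/-- The edges in `[s, L)` that are covered by intervals of `S` strictly inside. -/
noncomputable def innerEdges {N : ℕ} (S : Set (Fin N × Fin N × Fin N)) (s L : ℕ) : Finset ℕ :=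
  (Finset.Ico s L).filter fun e => ∃ c ∈ S, s < (c.1 : ℕ) ∧ (c.2.1 : ℕ) < L ∧ Covers c e

/-- Take `c` of maximal level among the intervals that cover `s`, and cut just after the last edge
of `c` that no faster interval covers. Beyond the cut `c` is redundant, because each of its edges
has a faster cover, so the rest is a fast cover without `c`; this is what later gives independence.
Before the cut, an edge is either slow at the level of `c`, which happens at most `2 ^ k` times, or
has a faster cover, which is trapped strictly inside the piece. -/
theorem FastCover.exists_first {N : ℕ} {S : Set (Fin N × Fin N × Fin N)} {s n : ℕ}
    (h : FastCover S s n) (hs : s < n) :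
    ∃ c ∈ S, ∃ L, s < L ∧ L ≤ n ∧ (c.1 : ℕ) ≤ s ∧ L ≤ (c.2.1 : ℕ) ∧ FastCover (S \ {c}) L n ∧
      (L - s ≤ 2 * 2 ^ (c.2.2 : ℕ) ∨ L - s ≤ 2 * (innerEdges S s L).card) := by
  classical
  obtain ⟨c, ⟨hcS, hcs⟩, hmax⟩ := Set.exists_max_image {c | c ∈ S ∧ Covers c s}
    (fun c => (c.2.2 : ℕ)) (Set.toFinite _) (by
      obtain ⟨c, hc⟩ := h.1 s le_rfl hs
      exact ⟨c, hc⟩)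
  set A := (slowEdges S s n c.2.2).filter fun e => e < (c.2.1 : ℕ) with hA
  have hmem : ∀ e, e ∈ A ↔ (s ≤ e ∧ e < n) ∧ (∀ c' ∈ S, Covers c' e → (c'.2.2 : ℕ) ≤ c.2.2) ∧
      e < (c.2.1 : ℕ) := by
    intro e
    simp [hA, slowEdges, and_assoc]
  have hsA : s ∈ A := (hmem s).2 ⟨⟨le_rfl, hs⟩, fun c' h1 h2 => hmax c' ⟨h1, h2⟩, hcs.2⟩
  -- The cut is `L = e₀ + 1`: every later edge of `c` has a cover of strictly higher level.
  obtain ⟨e₀, he₀, hlast⟩ := A.exists_max_image id ⟨s, hsA⟩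
  obtain ⟨⟨h1, h2⟩, h3, h4⟩ := (hmem e₀).1 he₀
  have hfast : ∀ e, e₀ < e → e < n → Covers c e →
      ∃ c' ∈ S, Covers c' e ∧ (c.2.2 : ℕ) < c'.2.2 := by
    intro e he hen hce
    by_contra! H
    have := hlast e ((hmem e).2 ⟨⟨by omega, hen⟩, H, hce.2⟩)
    simp only [id] at this
    omega
  refine ⟨c, hcS, e₀ + 1, by omega, by omega, hcs.1, by omega, ⟨?_, ?_⟩, ?_⟩
  · intro e he hen
    by_cases hce : Covers c e
    · obtain ⟨c', h5, h6, h7⟩ := hfast e (by omega) hen hce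
      refine ⟨c', ⟨h5, ?_⟩, h6⟩
      rintro rfl
      omega
    · obtain ⟨c', h5, h6⟩ := h.1 e (by omega) hen
      refine ⟨c', ⟨h5, ?_⟩, h6⟩
      rintro rfl
      exact hce h6
  · intro k
    refine (Finset.card_le_card ?_).trans (h.2 k)
    intro e he
    simp only [slowEdges, Finset.mem_filter, Finset.mem_Ico] at he ⊢
    obtain ⟨⟨h5, h6⟩, h7⟩ := he
    refine ⟨⟨by omega, h6⟩, fun c' h8 h9 => ?_⟩
    -- When `c` itself covers `e`, a faster interval is left after its removal, and the bound on the
    -- level of that interval also bounds the level of `c`.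
    by_cases hcc : c' = c
    · subst hcc
      obtain ⟨c'', h10, h11, h12⟩ := hfast e (by omega) h6 h9
      have := h7 c'' ⟨h10, by rintro rfl; omega⟩ h11
      omega
    · exact h7 c' ⟨h8, hcc⟩ h9
  · by_contra! H
    obtain ⟨H1, H2⟩ := H
    have hsub : Finset.Ico s (e₀ + 1) ⊆ slowEdges S s n c.2.2 ∪ innerEdges S s (e₀ + 1) := by
      intro e he
      rw [Finset.mem_union]
      by_contra! hne
      rw [Finset.mem_Ico] at he
      obtain ⟨hn1, hn2⟩ := hne
      simp only [slowEdges, innerEdges, Finset.mem_filter, Finset.mem_Ico, not_and, not_forall,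
        not_exists] at hn1 hn2
      obtain ⟨c', h5, h6, h7⟩ := hn1 ⟨he.1, by omega⟩
      refine hn2 he c' h5 ?_ ?_ h6
      -- A cover faster than `c` cannot contain `s`, by maximality of `c`, and cannot contain `e₀`,
      -- which has no cover faster than `c`; hence it lies strictly between the ends of the piece.
      · by_contra hlt
        exact h7 (hmax c' ⟨h5, by omega, by have := h6.2; omega⟩)
      · by_contra hlt
        exact h7 (h3 c' h5 ⟨by have := h6.1; omega, by omega⟩)
    have h5 := (Finset.card_le_card hsub).trans (Finset.card_union_le _ _)
    have h6 := h.2 c.2.2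
    rw [Nat.card_Ico] at h5
    omega

theorem slowEdges_anti {N : ℕ} {S S' : Set (Fin N × Fin N × Fin N)} {s n k : ℕ}
    (h : ∀ c ∈ S, s < (c.2.1 : ℕ) → c ∈ S') : slowEdges S' s n k ⊆ slowEdges S s n k := by
  intro e he
  simp only [slowEdges, Finset.mem_filter, Finset.mem_Ico] at he ⊢
  exact ⟨he.1, fun c hc hce => he.2 c (h c hc (he.1.1.trans_lt hce.2)) hce⟩

/-- Intervals that end at or before `s` cover no edge from `s` on, so they can be ignored, and
additional intervals only help. This localises the event to a set of classes. -/
theorem FastCover.mono {N : ℕ} {S S' : Set (Fin N × Fin N × Fin N)} {s n : ℕ}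
    (hS : FastCover S s n) (h : ∀ c ∈ S, s < (c.2.1 : ℕ) → c ∈ S') : FastCover S' s n := by
  refine ⟨fun e he hen => ?_, fun k => (Finset.card_le_card (slowEdges_anti h)).trans (hS.2 k)⟩
  obtain ⟨c, hc, hce⟩ := hS.1 e he hen
  exact ⟨c, h c hc (he.trans_lt hce.2), hce⟩

theorem innerEdges_mono {N : ℕ} {S S' : Set (Fin N × Fin N × Fin N)} {s L : ℕ}
    (h : ∀ c ∈ S, (c.2.1 : ℕ) < L → c ∈ S') : innerEdges S s L ⊆ innerEdges S' s L := by
  intro e he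
  simp only [innerEdges, Finset.mem_filter, Finset.mem_Ico] at he ⊢
  obtain ⟨h1, c, h2, h3, h4, h5⟩ := he
  exact ⟨h1, c, h c h2 h4, h3, h4, h5⟩

/-- The random set of the indices `c` for which `X c` occurs. -/
def occurring {Ω ι : Type*} (X : ι → Ω → Prop) (ω : Ω) : Set ι := {c | X c ω}

/-- Events that depend on disjoint sets of independent events are independent. -/
theorem measure_occurring_inter {Ω ι : Type*} [MeasurableSpace Ω] {P : Measure Ω} [Fintype ι]
    {X : ι → Ω → Prop} (hX : ∀ c, Measurable (X c)) (hi : iIndepFun X P) (T₁ T₂ : Finset ι)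
    (hT : Disjoint T₁ T₂) (A₁ A₂ : Set ι → Prop) (h₁ : ∀ S, A₁ S ↔ A₁ (S ∩ T₁))
    (h₂ : ∀ S, A₂ S ↔ A₂ (S ∩ T₂)) :
    P {ω | A₁ (occurring X ω) ∧ A₂ (occurring X ω)} =
      P {ω | A₁ (occurring X ω)} * P {ω | A₂ (occurring X ω)} := by
  have h := hi.indepFun_finset T₁ T₂ hT hX
  have key : ∀ (T : Finset ι) (A : Set ι → Prop), (∀ S, A S ↔ A (S ∩ T)) →
      {ω | A (occurring X ω)} = (fun ω (i : T) => X i ω) ⁻¹'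
        {g : T → Prop | A {c | ∃ h : c ∈ T, g ⟨c, h⟩}} := by
    intro T A hA
    ext ω
    rw [Set.mem_ofPred_eq, hA, Set.mem_preimage, Set.mem_ofPred_eq]
    have : occurring X ω ∩ T = {c | ∃ _ : c ∈ T, X c ω} := by
      ext c
      simp [occurring, and_comm]
    rw [this]
  have := h.measure_inter_preimage_eq_mul {g | A₁ {c | ∃ h : c ∈ T₁, g ⟨c, h⟩}}
    {g | A₂ {c | ∃ h : c ∈ T₂, g ⟨c, h⟩}} (.of_discrete) (.of_discrete)
  rw [← key T₁ A₁ h₁, ← key T₂ A₂ h₂] at this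
  exact this

/-! ## Many edges covered by short intervals -/

section Chernoff

variable {Ω : Type*} [MeasurableSpace Ω] {P : Measure Ω} [IsProbabilityMeasure P] {N : ℕ}
  {X : Fin N × Fin N × Fin N → Ω → Prop} {δ q : ℝ≥0}

open Classical in
/-- The intervals strictly inside `[s, L)`. -/
noncomputable def innerClasses (N s L : ℕ) : Finset (Fin N × Fin N × Fin N) :=
  Finset.univ.filter fun c => s < (c.1 : ℕ) ∧ (c.1 : ℕ) < c.2.1 ∧ (c.2.1 : ℕ) < L

/-- There are `L - s` possible starting points, the geometric sum over lengths is at most `4`, and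
that over levels is at most `2`. -/
theorem sum_innerClasses_le (hq : (q : ℝ) ≤ 1 / 2) (N s L : ℕ) :
    ∑ c ∈ innerClasses N s L,
      (δ : ℝ) * (3 / 4) ^ ((c.2.1 : ℕ) - c.1) * (q : ℝ) ^ (c.2.2 : ℕ) ≤ 8 * δ * (L - s : ℕ) := by
  classical
  let φ : Fin N × Fin N × Fin N → ℕ × ℕ × ℕ := fun c => (c.1, c.2.1 - c.1, c.2.2)
  have hinj : Set.InjOn φ (innerClasses N s L) := by
    rintro ⟨a, b, k⟩ h ⟨a', b', k'⟩ h' he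
    simp only [innerClasses, Finset.coe_filter, Finset.mem_univ, true_and, Set.mem_ofPred_eq] at h h'
    simp only [φ, Prod.mk.injEq] at he
    simp only [Prod.mk.injEq, Fin.ext_iff]
    omega
  have h1 : ∑ c ∈ innerClasses N s L,
      (δ : ℝ) * (3 / 4) ^ ((c.2.1 : ℕ) - c.1) * (q : ℝ) ^ (c.2.2 : ℕ) =
      ∑ d ∈ (innerClasses N s L).image φ, (δ : ℝ) * (3 / 4) ^ d.2.1 * (q : ℝ) ^ d.2.2 := by
    rw [Finset.sum_image hinj]
  have h2 : (innerClasses N s L).image φ ⊆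
      Finset.Ico s L ×ˢ (Finset.range N ×ˢ Finset.range N) := by
    intro d hd
    obtain ⟨c, hc, rfl⟩ := Finset.mem_image.1 hd
    simp only [innerClasses, Finset.mem_filter, Finset.mem_univ, true_and] at hc
    simp only [φ, Finset.mem_product, Finset.mem_Ico, Finset.mem_range]
    have := c.2.1.2
    have := c.2.2.2
    omega
  have hgeom : ∀ x : ℝ, 0 ≤ x → x < 1 → ∑ i ∈ Finset.range N, x ^ i ≤ (1 - x)⁻¹ := by
    intro x h0 h1
    rw [← tsum_geometric_of_lt_one h0 h1]
    exact (summable_geometric_of_lt_one h0 h1).sum_le_tsum _ fun i _ => by positivity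
  have h34 := hgeom (3 / 4) (by norm_num) (by norm_num)
  have hqs : ∑ i ∈ Finset.range N, (q : ℝ) ^ i ≤ 2 := by
    refine (hgeom q q.2 (by linarith)).trans ?_
    rw [inv_le_comm₀ (by linarith) (by norm_num)]
    linarith
  rw [h1]
  refine (Finset.sum_le_sum_of_subset_of_nonneg h2 fun d _ _ => by positivity).trans ?_
  rw [Finset.sum_product]
  simp only [Finset.sum_product, Finset.sum_const, Nat.card_Ico, nsmul_eq_mul]
  have h3 : ∑ x ∈ Finset.range N, ∑ y ∈ Finset.range N, (δ : ℝ) * (3 / 4) ^ x * (q : ℝ) ^ y =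
      δ * ((∑ x ∈ Finset.range N, (3 / 4 : ℝ) ^ x) * ∑ y ∈ Finset.range N, (q : ℝ) ^ y) := by
    rw [Finset.sum_mul_sum, Finset.mul_sum]
    refine Finset.sum_congr rfl fun i _ => ?_
    rw [Finset.mul_sum]
    exact Finset.sum_congr rfl fun j _ => by ring
  rw [h3]
  have h4 : (∑ x ∈ Finset.range N, (3 / 4 : ℝ) ^ x) * ∑ y ∈ Finset.range N, (q : ℝ) ^ y ≤ 4 * 2 :=
    mul_le_mul (h34.trans (by norm_num)) hqs (by positivity) (by norm_num)
  have h5 := mul_le_mul_of_nonneg_left h4 δ.2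
  have h6 := mul_le_mul_of_nonneg_left h5 (Nat.cast_nonneg (α := ℝ) (L - s))
  refine h6.trans (le_of_eq ?_)
  have : (δ.1 : ℝ) = δ := rfl
  rw [this]
  ring

open Classical in
theorem card_innerEdges_le (S : Set (Fin N × Fin N × Fin N)) (s L : ℕ) :
    (innerEdges S s L).card ≤
      ∑ c ∈ innerClasses N s L, if c ∈ S then (c.2.1 : ℕ) - c.1 else 0 := by
  rw [← Finset.sum_filter]
  have : innerEdges S s L ⊆ ((innerClasses N s L).filter (· ∈ S)).biUnion
      fun c => Finset.Ico (c.1 : ℕ) c.2.1 := by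
    intro e he
    simp only [innerEdges, Finset.mem_filter, Finset.mem_Ico] at he
    obtain ⟨h1, c, h2, h3, h4, h5⟩ := he
    simp only [Finset.mem_biUnion, Finset.mem_filter, innerClasses, Finset.mem_univ, true_and,
      Finset.mem_Ico]
    exact ⟨c, ⟨⟨h3, h5.1.trans_lt h5.2, h4⟩, h2⟩, h5.1, h5.2⟩
  refine (Finset.card_le_card this).trans (Finset.card_biUnion_le.trans ?_)
  simp

theorem exp_quarter_le : Real.exp (1 / 4) ≤ 3 / 2 := by
  have h := Real.exp_bound' (x := 1 / 4) (by norm_num) (by norm_num) (n := 3) (by norm_num)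
  refine h.trans ?_
  norm_num [Finset.sum_range_succ, Nat.factorial]

/-- A Chernoff bound for the sum of the lengths of the occurring inner intervals, which dominates
the number of inner edges. Exponential moments exist because long intervals are exponentially rare:
with parameter `1 / 4`, the factor `2⁻¹ ^ a` becomes at most `(3 / 4) ^ a`. -/
theorem measure_innerEdges_le (hX : ∀ c, Measurable (X c)) (hi : iIndepFun X P)
    (hp : ∀ c, (c.1 : ℕ) < c.2.1 →
      P {ω | X c ω} ≤ ((δ * 2⁻¹ ^ ((c.2.1 : ℕ) - c.1) * q ^ (c.2.2 : ℕ) : ℝ≥0) : ℝ≥0∞))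
    (hq : (q : ℝ) ≤ 1 / 2) (hδ : (δ : ℝ) ≤ 1 / 128) (s L : ℕ) :
    P {ω | L - s ≤ 2 * (innerEdges (occurring X ω) s L).card} ≤
      ENNReal.ofReal (Real.exp (-(1 / 16))) ^ (L - s) := by
  classical
  let Y : Fin N × Fin N × Fin N → Ω → ℝ :=
    fun c ω => if X c ω then (((c.2.1 : ℕ) - c.1 : ℕ) : ℝ) else 0
  have hg : ∀ c : Fin N × Fin N × Fin N, Measurable
      fun a : Prop => if a then (((c.2.1 : ℕ) - c.1 : ℕ) : ℝ) else 0 := fun c => .of_discrete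
  have hY : ∀ c, Measurable (Y c) := fun c => (hg c).comp (hX c)
  have hYi : iIndepFun Y P := hi.comp _ hg
  have hYb : ∀ c ω, |Y c ω| ≤ N := by
    intro c ω
    have h1 : (((c.2.1 : ℕ) - c.1 : ℕ) : ℝ) ≤ N := by
      have := c.2.1.2
      exact_mod_cast (show (c.2.1 : ℕ) - c.1 ≤ N by omega)
    simp only [Y]
    split_ifs
    · rwa [abs_of_nonneg (by positivity)]
    · simp
  set Z : Ω → ℝ := ∑ c ∈ innerClasses N s L, Y c with hZ
  have hint : Integrable (fun ω => Real.exp (1 / 4 * Z ω)) P := by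
    have hZm : Measurable Z := by
      simp only [hZ, Finset.sum_fn]
      exact Finset.measurable_sum _ fun c _ => hY c
    refine Integrable.of_bound (by fun_prop)
      (Real.exp (1 / 4 * ∑ c ∈ innerClasses N s L, (N : ℝ))) (ae_of_all _ fun ω => ?_)
    rw [Real.norm_eq_abs, Real.abs_exp, Real.exp_le_exp, hZ, Finset.sum_apply]
    exact mul_le_mul_of_nonneg_left
      (Finset.sum_le_sum fun c _ => (le_abs_self _).trans (hYb c ω)) (by norm_num)
  have hmgf : ∀ c ∈ innerClasses N s L, mgf (Y c) P (1 / 4) ≤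
      Real.exp (δ * (3 / 4) ^ ((c.2.1 : ℕ) - c.1) * (q : ℝ) ^ (c.2.2 : ℕ)) := by
    intro c hc
    simp only [innerClasses, Finset.mem_filter, Finset.mem_univ, true_and] at hc
    set a := (c.2.1 : ℕ) - c.1 with ha
    have hev : MeasurableSet {ω | X c ω} := measurableSet_setOfPred.2 (hX c)
    have h1 : (fun ω => Real.exp (1 / 4 * Y c ω)) =
        fun ω => 1 + {ω | X c ω}.indicator (fun _ => Real.exp (1 / 4 * a) - 1) ω := by
      funext ω
      by_cases h : X c ω <;> simp [Y, h, ha]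
    have hpc : P.real {ω | X c ω} ≤ δ * 2⁻¹ ^ a * (q : ℝ) ^ (c.2.2 : ℕ) := by
      have := ENNReal.toReal_mono ENNReal.coe_ne_top (hp c hc.2.1)
      simpa [Measure.real, ha] using this
    rw [mgf, h1, integral_add (integrable_const _) ((integrable_const _).indicator hev),
      integral_indicator_const _ hev]
    simp only [integral_const, probReal_univ, smul_eq_mul, mul_one]
    have h2 : Real.exp (1 / 4 * a) ≤ (3 / 2) ^ a := by
      rw [mul_comm, Real.exp_nat_mul]
      exact pow_le_pow_left₀ (Real.exp_pos _).le exp_quarter_le _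
    have h3 : P.real {ω | X c ω} * (Real.exp (1 / 4 * a) - 1) ≤
        δ * (3 / 4) ^ a * (q : ℝ) ^ (c.2.2 : ℕ) := by
      calc P.real {ω | X c ω} * (Real.exp (1 / 4 * a) - 1)
          ≤ P.real {ω | X c ω} * (3 / 2) ^ a :=
            mul_le_mul_of_nonneg_left (by linarith) measureReal_nonneg
        _ ≤ (δ * 2⁻¹ ^ a * (q : ℝ) ^ (c.2.2 : ℕ)) * (3 / 2) ^ a :=
            mul_le_mul_of_nonneg_right hpc (by positivity)
        _ = δ * (3 / 4) ^ a * (q : ℝ) ^ (c.2.2 : ℕ) := by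
            rw [show (3 / 4 : ℝ) = 2⁻¹ * (3 / 2) by norm_num, mul_pow]
            ring
    linarith [Real.add_one_le_exp (δ * (3 / 4) ^ a * (q : ℝ) ^ (c.2.2 : ℕ))]
  -- The exponent per unit of length is at most `-(1 / 4) * (1 / 2) + 8 * δ`, which is at most `-(1
  -- / 16)` since `δ ≤ 1 / 128`.
  have hmain := measure_ge_le_exp_mul_mgf (X := Z) (μ := P) (((L - s : ℕ) : ℝ) / 2)
    (by norm_num : (0 : ℝ) ≤ 1 / 4) hint
  have hprod : mgf Z P (1 / 4) ≤ Real.exp (8 * δ * (L - s : ℕ)) := by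
    rw [hZ, hYi.mgf_sum hY]
    refine (Finset.prod_le_prod (fun c _ => mgf_nonneg) hmgf).trans ?_
    rw [← Real.exp_sum]
    exact Real.exp_le_exp.2 (sum_innerClasses_le hq N s L)
  have hsub : {ω | L - s ≤ 2 * (innerEdges (occurring X ω) s L).card} ⊆
      {ω | ((L - s : ℕ) : ℝ) / 2 ≤ Z ω} := by
    intro ω hω
    rw [Set.mem_ofPred_eq] at hω ⊢
    have h1 := hω.trans (Nat.mul_le_mul_left 2 (card_innerEdges_le (occurring X ω) s L))
    have h2 : ((L - s : ℕ) : ℝ) ≤ 2 * Z ω := by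
      rw [hZ, Finset.sum_apply]
      have h3 : ((L - s : ℕ) : ℝ) ≤ _ := Nat.cast_le.2 h1
      refine h3.trans (le_of_eq ?_)
      push_cast
      simp only [Y, occurring, Set.mem_ofPred_eq]
      congr!
    linarith
  refine (measure_mono hsub).trans ?_
  rw [← ENNReal.ofReal_pow (Real.exp_pos _).le, ← ENNReal.ofReal_toReal (measure_ne_top P _)]
  refine ENNReal.ofReal_le_ofReal (hmain.trans ?_)
  refine (mul_le_mul_of_nonneg_left hprod (Real.exp_pos _).le).trans ?_
  rw [← Real.exp_add, ← Real.exp_nat_mul, Real.exp_le_exp]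
  have : (0 : ℝ) ≤ ((L - s : ℕ) : ℝ) := Nat.cast_nonneg _
  nlinarith

end Chernoff

/-! ## Renewal sequences -/

/-- The renewal sequence `u (m + 1) = ∑ l ≤ m, w (l + 1) u (m - l)`, `u 0 = 1`. -/
noncomputable def renewal (w : ℕ → ℝ≥0∞) : ℕ → ℝ≥0∞
  | 0 => 1
  | m + 1 => ∑ l : Fin (m + 1), w (l + 1) * renewal w (m - l)

theorem renewal_succ (w : ℕ → ℝ≥0∞) (m : ℕ) :
    renewal w (m + 1) = ∑ l ∈ Finset.range (m + 1), w (l + 1) * renewal w (m - l) := by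
  rw [renewal, Finset.sum_range]

/-- The renewal equation is a convolution, so each partial sum is at most `W` times one plus the
preceding partial sum; the bound `S` is preserved by this recursion. -/
theorem sum_renewal_le {w : ℕ → ℝ≥0∞} {W S : ℝ≥0∞} (hw : ∑' l, w (l + 1) ≤ W)
    (hS : W * (1 + S) ≤ S) (M : ℕ) : ∑ m ∈ Finset.range M, renewal w (m + 1) ≤ S := by
  induction M with
  | zero => simp
  | succ M ih =>
    have h1 : ∀ k ∈ Finset.range (M + 1),
        ∑ m ∈ Finset.range (M + 1 - k), w (k + 1) * renewal w m ≤
          w (k + 1) * ∑ m ∈ Finset.range (M + 1), renewal w m := by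
      intro k _
      rw [Finset.mul_sum]
      exact Finset.sum_le_sum_of_subset (Finset.range_mono (by omega))
    have h2 : ∑ m ∈ Finset.range (M + 1), renewal w m ≤ 1 + S := by
      rw [Finset.sum_range_succ', add_comm, renewal]
      exact add_le_add_right ih _
    simp only [renewal_succ]
    rw [Finset.sum_range_diag_flip (M + 1) fun k j => w (k + 1) * renewal w j]
    refine (Finset.sum_le_sum h1).trans ?_
    rw [← Finset.sum_mul]
    exact (mul_le_mul' ((ENNReal.sum_le_tsum _).trans hw) h2).trans hS

theorem tsum_renewal_le {w : ℕ → ℝ≥0∞} {W S : ℝ≥0∞} (hw : ∑' l, w (l + 1) ≤ W)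
    (hS : W * (1 + S) ≤ S) : ∑' m, renewal w (m + 1) ≤ S :=
  ENNReal.tsum_le_of_sum_range_le (sum_renewal_le hw hS)

/-! ## The probability of a fast cover -/

/-- The base of the exponential bound of `measure_innerEdges_le`. -/
noncomputable def innerRate : ℝ≥0∞ := ENNReal.ofReal (Real.exp (-(1 / 16)))

/-- The level weight of a first interval of length `l`. -/
noncomputable def levelWeight (q : ℝ≥0) (l k : ℕ) : ℝ≥0∞ :=
  (q : ℝ≥0∞) ^ k * ((if l ≤ 2 * 2 ^ k then 1 else 0) + innerRate ^ l)

/-- The weight of a first interval of length `l`. -/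
noncomputable def coverWeight (δ q : ℝ≥0) (l : ℕ) : ℝ≥0∞ :=
  4 * δ * ∑' k, levelWeight q l k

theorem innerRate_lt_one : innerRate < 1 := by
  rw [innerRate, ← ENNReal.ofReal_one, ENNReal.ofReal_lt_ofReal_iff one_pos]
  rw [← Real.exp_zero]
  exact Real.exp_lt_exp.2 (by norm_num)

/-- The total of the weights is at most `δ` times this constant. -/
noncomputable def weightConst (q : ℝ≥0) : ℝ≥0∞ :=
  4 * (2 * (1 - 2 * (q : ℝ≥0∞))⁻¹ + (1 - (q : ℝ≥0∞))⁻¹ * (1 - innerRate)⁻¹)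

/-- Here the condition `β > 2` is decisive, in the form `q * 2 < 1`: the geometric series of ratio
`2 * q` must converge. -/
theorem weightConst_ne_top {q : ℝ≥0} (hq : (q : ℝ≥0∞) * 2 < 1) : weightConst q ≠ ∞ := by
  have hq' : (q : ℝ≥0∞) < 1 := lt_of_le_of_lt (le_mul_of_one_le_right' (by norm_num)) hq
  have h1 : (1 - 2 * (q : ℝ≥0∞))⁻¹ ≠ ∞ :=
    ENNReal.inv_ne_top.2 (tsub_pos_of_lt (by rwa [mul_comm])).ne'
  have h2 : (1 - (q : ℝ≥0∞))⁻¹ ≠ ∞ := ENNReal.inv_ne_top.2 (tsub_pos_of_lt hq').ne'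
  have h3 : (1 - innerRate)⁻¹ ≠ ∞ := ENNReal.inv_ne_top.2 (tsub_pos_of_lt innerRate_lt_one).ne'
  unfold weightConst
  exact ENNReal.mul_ne_top (by norm_num) (ENNReal.add_ne_top.2
    ⟨ENNReal.mul_ne_top (by norm_num) h1, ENNReal.mul_ne_top h2 h3⟩)

/-- Sum over `l` before `k`: at level `k` there are `2 * 2 ^ k` admissible lengths, whence the ratio
`2 * q`, and the inner-interval term is geometric in `l`. -/
theorem tsum_coverWeight_le (δ q : ℝ≥0) :
    ∑' l, coverWeight δ q (l + 1) ≤ δ * weightConst q := by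
  have h1 : ∀ k : ℕ, ∑' l : ℕ, levelWeight q (l + 1) k ≤
      2 * (2 * (q : ℝ≥0∞)) ^ k + (q : ℝ≥0∞) ^ k * (1 - innerRate)⁻¹ := by
    intro k
    unfold levelWeight
    rw [ENNReal.tsum_mul_left, ENNReal.tsum_add, mul_add]
    refine add_le_add ?_ (mul_le_mul_right ?_ _)
    · have : ∑' l : ℕ, (if l + 1 ≤ 2 * 2 ^ k then (1 : ℝ≥0∞) else 0) = 2 * 2 ^ k := by
        rw [tsum_eq_sum (s := Finset.range (2 * 2 ^ k))]
        · rw [Finset.sum_congr rfl fun l hl =>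
            if_pos (show l + 1 ≤ 2 * 2 ^ k from Finset.mem_range.1 hl)]
          simp
        · intro l hl
          rw [Finset.mem_range] at hl
          exact if_neg (by omega)
      rw [this, mul_pow]
      exact le_of_eq (by ring)
    · rw [← ENNReal.tsum_geometric]
      refine ENNReal.tsum_le_tsum fun l => ?_
      rw [pow_succ]
      exact mul_le_of_le_one_right' innerRate_lt_one.le
  unfold coverWeight
  rw [ENNReal.tsum_mul_left, ENNReal.tsum_comm]
  refine (mul_le_mul_right (ENNReal.tsum_le_tsum h1) _).trans (le_of_eq ?_)
  rw [ENNReal.tsum_add, ENNReal.tsum_mul_left, ENNReal.tsum_mul_right, ENNReal.tsum_geometric,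
    ENNReal.tsum_geometric, weightConst]
  ring

open Classical in
/-- The intervals that contain `[s, L)`. -/
noncomputable def outerClasses (N s L : ℕ) : Finset (Fin N × Fin N × Fin N) :=
  Finset.univ.filter fun c => (c.1 : ℕ) ≤ s ∧ L ≤ (c.2.1 : ℕ)

theorem sum_outerClasses_le {δ q : ℝ≥0} (N : ℕ) {s L : ℕ} (hsL : s < L) :
    ∑ c ∈ outerClasses N s L, ((δ * 2⁻¹ ^ ((c.2.1 : ℕ) - c.1) : ℝ≥0) : ℝ≥0∞) *
      levelWeight q (L - s) c.2.2 ≤ 2⁻¹ ^ (L - s) * coverWeight δ q (L - s) := by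
  classical
  -- In terms of the overhangs to the left of `s` and to the right of `L`, the weight factorises.
  -- Each overhang contributes a geometric sum equal to `2`, whence the factor `4` in `coverWeight`.
  let φ : Fin N × Fin N × Fin N → ℕ × ℕ × ℕ := fun c => (s - c.1, c.2.1 - L, c.2.2)
  let G : ℕ × ℕ × ℕ → ℝ≥0∞ := fun d =>
    δ * 2⁻¹ ^ (L - s) * (2⁻¹ ^ d.1 * (2⁻¹ ^ d.2.1 * levelWeight q (L - s) d.2.2))
  have hinj : Set.InjOn φ (outerClasses N s L) := by
    rintro ⟨a, b, k⟩ h ⟨a', b', k'⟩ h' he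
    simp only [outerClasses, Finset.coe_filter, Finset.mem_univ, true_and,
      Set.mem_ofPred_eq] at h h'
    simp only [φ, Prod.mk.injEq] at he
    simp only [Prod.mk.injEq, Fin.ext_iff]
    omega
  have h1 : ∀ c ∈ outerClasses N s L, ((δ * 2⁻¹ ^ ((c.2.1 : ℕ) - c.1) : ℝ≥0) : ℝ≥0∞) *
      levelWeight q (L - s) c.2.2 = G (φ c) := by
    intro c hc
    simp only [outerClasses, Finset.mem_filter, Finset.mem_univ, true_and] at hc
    simp only [G, φ]
    rw [show (c.2.1 : ℕ) - c.1 = (L - s) + (s - c.1) + (c.2.1 - L) by omega, pow_add, pow_add]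
    push_cast
    ring
  rw [Finset.sum_congr rfl h1, ← Finset.sum_image (f := G) hinj]
  refine (ENNReal.sum_le_tsum _).trans (le_of_eq ?_)
  simp only [G]
  rw [ENNReal.tsum_mul_left, ENNReal.tsum_prod' (f := fun i : ℕ × ℕ × ℕ => _)]
  simp only [ENNReal.tsum_mul_left, ENNReal.tsum_mul_right]
  rw [ENNReal.tsum_prod' (f := fun i : ℕ × ℕ => _)]
  simp only [ENNReal.tsum_mul_left, ENNReal.tsum_mul_right]
  rw [ENNReal.tsum_geometric, ENNReal.one_sub_inv_two, inv_inv, coverWeight]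
  ring

section Cover

variable {Ω : Type*} [MeasurableSpace Ω] {P : Measure Ω} [IsProbabilityMeasure P] {N : ℕ}
  {X : Fin N × Fin N × Fin N → Ω → Prop} {δ q : ℝ≥0}

/-- The first factor involves only `c` and the intervals ending before `L`; the second only the
intervals other than `c` ending after `L`. These sets of classes are disjoint, so the events are
independent. In the first factor, `c` reaches `L` and is therefore also independent of the inner
intervals. -/
theorem measure_first_le (hX : ∀ c, Measurable (X c)) (hi : iIndepFun X P)
    (hp : ∀ c, (c.1 : ℕ) < c.2.1 →
      P {ω | X c ω} ≤ ((δ * 2⁻¹ ^ ((c.2.1 : ℕ) - c.1) * q ^ (c.2.2 : ℕ) : ℝ≥0) : ℝ≥0∞))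
    (hq : (q : ℝ) ≤ 1 / 2) (hδ : (δ : ℝ) ≤ 1 / 128) {s L n : ℕ} (hsL : s < L)
    {c : Fin N × Fin N × Fin N} (hc : c ∈ outerClasses N s L) :
    P {ω | (c ∈ occurring X ω ∧ (L - s ≤ 2 * 2 ^ (c.2.2 : ℕ) ∨
        L - s ≤ 2 * (innerEdges (occurring X ω) s L).card)) ∧
        FastCover (occurring X ω \ {c}) L n} ≤
      ((δ * 2⁻¹ ^ ((c.2.1 : ℕ) - c.1) : ℝ≥0) : ℝ≥0∞) * levelWeight q (L - s) c.2.2 *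
        P {ω | FastCover (occurring X ω) L n} := by
  classical
  simp only [outerClasses, Finset.mem_filter, Finset.mem_univ, true_and] at hc
  let T₁ : Finset (Fin N × Fin N × Fin N) := insert c (Finset.univ.filter fun c' => c'.2.1 < L)
  let T₂ : Finset (Fin N × Fin N × Fin N) :=
    (Finset.univ.filter fun c' => L < c'.2.1).erase c
  let T₃ : Finset (Fin N × Fin N × Fin N) := Finset.univ.filter fun c' => c'.2.1 < L
  have hin : ∀ S : Set (Fin N × Fin N × Fin N), ∀ T : Finset (Fin N × Fin N × Fin N),
      T₃ ⊆ T → innerEdges S s L = innerEdges (S ∩ T) s L := by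
    intro S T hT
    refine Finset.Subset.antisymm (innerEdges_mono fun c' h h' => ⟨h, hT ?_⟩)
      (innerEdges_mono fun c' h _ => h.1)
    simpa [T₃] using h'
  have hfc : ∀ S : Set (Fin N × Fin N × Fin N),
      FastCover (S \ {c}) L n ↔ FastCover ((S ∩ T₂) \ {c}) L n := by
    refine fun S => ⟨fun h => h.mono fun c' h1 h2 => ⟨⟨h1.1, ?_⟩, h1.2⟩,
      fun h => h.mono fun c' h1 _ => ⟨h1.1.1, h1.2⟩⟩
    have : c' ≠ c := h1.2
    simpa [T₂, this] using h2
  have hd : Disjoint T₁ T₂ := by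
    rw [Finset.disjoint_left]
    intro c' h1 h2
    simp only [T₁, T₂, Finset.mem_insert, Finset.mem_filter, Finset.mem_univ, true_and,
      Finset.mem_erase] at h1 h2
    rcases h1 with h1 | h1
    · exact h2.1 h1
    · omega
  rw [measure_occurring_inter hX hi T₁ T₂ hd
    (fun S => c ∈ S ∧ (L - s ≤ 2 * 2 ^ (c.2.2 : ℕ) ∨ L - s ≤ 2 * (innerEdges S s L).card))
    (fun S => FastCover (S \ {c}) L n)
    (fun S => by
      rw [hin S T₁ (Finset.subset_insert _ _)]
      simp [T₁]) hfc]
  refine mul_le_mul' ?_ (measure_mono fun ω hω => FastCover.mono hω fun c' h _ => h.1)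
  have hpc := hp c (by omega)
  have hinner : P {ω | c ∈ occurring X ω ∧ L - s ≤ 2 * (innerEdges (occurring X ω) s L).card} ≤
      P {ω | X c ω} * innerRate ^ (L - s) := by
    rw [measure_occurring_inter hX hi {c} T₃ (by
        rw [Finset.disjoint_singleton_left]
        simp only [T₃, Finset.mem_filter, Finset.mem_univ, true_and]
        omega)
      (fun S => c ∈ S) (fun S => L - s ≤ 2 * (innerEdges S s L).card)
      (fun S => by simp) (fun S => by rw [hin S T₃ subset_rfl])]
    exact mul_le_mul_right (measure_innerEdges_le hX hi hp hq hδ s L) _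
  have hsplit : P {ω | c ∈ occurring X ω ∧ (L - s ≤ 2 * 2 ^ (c.2.2 : ℕ) ∨
        L - s ≤ 2 * (innerEdges (occurring X ω) s L).card)} ≤
      P {ω | X c ω} * ((if L - s ≤ 2 * 2 ^ (c.2.2 : ℕ) then 1 else 0) + innerRate ^ (L - s)) := by
    by_cases h : L - s ≤ 2 * 2 ^ (c.2.2 : ℕ)
    · rw [if_pos h]
      refine (measure_mono fun ω hω => hω.1).trans ?_
      rw [mul_add, mul_one]
      exact le_self_add
    · simp only [h, false_or, if_false, zero_add]
      exact hinner
  refine (hsplit.trans (mul_le_mul_left hpc _)).trans (le_of_eq ?_)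
  rw [levelWeight, ENNReal.coe_mul, ENNReal.coe_pow, mul_assoc]

/-- Strong induction on the length: a union bound over the first cut and its interval reproduces the
renewal equation, and the powers of `2⁻¹` multiply along the pieces. -/
theorem measure_fastCover_le (hX : ∀ c, Measurable (X c)) (hi : iIndepFun X P)
    (hp : ∀ c, (c.1 : ℕ) < c.2.1 →
      P {ω | X c ω} ≤ ((δ * 2⁻¹ ^ ((c.2.1 : ℕ) - c.1) * q ^ (c.2.2 : ℕ) : ℝ≥0) : ℝ≥0∞))
    (hq : (q : ℝ) ≤ 1 / 2) (hδ : (δ : ℝ) ≤ 1 / 128) (m s : ℕ) :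
    P {ω | FastCover (occurring X ω) s (s + m)} ≤ 2⁻¹ ^ m * renewal (coverWeight δ q) m := by
  classical
  induction m using Nat.strong_induction_on generalizing s with
  | _ m ih =>
  rcases m with _ | m
  · simpa [renewal] using prob_le_one
  have hsub : {ω | FastCover (occurring X ω) s (s + (m + 1))} ⊆
      ⋃ l ∈ Finset.range (m + 1), ⋃ c ∈ outerClasses N s (s + (l + 1)),
        {ω | (c ∈ occurring X ω ∧ (s + (l + 1) - s ≤ 2 * 2 ^ (c.2.2 : ℕ) ∨
          s + (l + 1) - s ≤ 2 * (innerEdges (occurring X ω) s (s + (l + 1))).card)) ∧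
          FastCover (occurring X ω \ {c}) (s + (l + 1)) (s + (m + 1))} := by
    intro ω hω
    obtain ⟨c, h1, L, h2, h3, h4, h5, h6, h7⟩ := FastCover.exists_first hω (by omega)
    obtain ⟨l, rfl⟩ : ∃ l, L = s + (l + 1) := ⟨L - s - 1, by omega⟩
    simp only [Set.mem_iUnion]
    exact ⟨l, Finset.mem_range.2 (by omega), c, by simp [outerClasses, h4, h5], ⟨h1, h7⟩, h6⟩
  refine (measure_mono hsub).trans ((measure_biUnion_finset_le _ _).trans ?_)
  rw [renewal_succ, Finset.mul_sum]
  refine Finset.sum_le_sum fun l hl => ?_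
  rw [Finset.mem_range] at hl
  refine (measure_biUnion_finset_le _ _).trans ?_
  refine (Finset.sum_le_sum fun c hc =>
    measure_first_le hX hi hp hq hδ (show s < s + (l + 1) by omega) hc).trans ?_
  rw [← Finset.sum_mul]
  have h1 := ih (m - l) (by omega) (s + (l + 1))
  rw [show s + (l + 1) + (m - l) = s + (m + 1) by omega] at h1
  refine (mul_le_mul' (sum_outerClasses_le N (by omega)) h1).trans (le_of_eq ?_)
  have h2 : (2⁻¹ : ℝ≥0∞) ^ (m + 1) = 2⁻¹ ^ (l + 1) * 2⁻¹ ^ (m - l) := by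
    rw [← pow_add]
    congr 1
    omega
  rw [show s + (l + 1) - s = l + 1 by omega, h2]
  ring

end Cover

/-! ## The topology of the space of lines -/

theorem isOpen_revPrefix_eq (n : ℕ) (w : List (Fin 2)) : IsOpen {b | revPrefix b n = w} := by
  induction n generalizing w with
  | zero =>
    simp only [revPrefix]
    exact isOpen_const
  | succ n ih =>
    rcases w with _ | ⟨a, w⟩
    · simp [revPrefix]
    · have : {b | revPrefix b (n + 1) = a :: w} = (fun b => b n) ⁻¹' {a} ∩ {b | revPrefix b n = w} := by
        ext b
        simp [revPrefix]
      rw [this]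
      exact ((isOpen_discrete _).preimage (continuous_apply n)).inter (ih w)

theorem isOpen_vertex_eq (n : ℕ) (x : Vertex) : IsOpen {ξ : Ray | ξ.vertex n = x} := by
  rcases n with _ | n
  · simp only [Ray.vertex]
    exact isOpen_const
  · rcases x with _ | ⟨i, w⟩
    · simp [Ray.vertex]
    · have : {ξ : Ray | ξ.vertex (n + 1) = some (i, w)} =
          Prod.fst ⁻¹' {i} ∩ Prod.snd ⁻¹' {b | revPrefix b n = w} := by
        ext ξ
        simp [Ray.vertex]
      rw [this]
      exact ((isOpen_discrete _).preimage continuous_fst).inter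
        ((isOpen_revPrefix_eq n w).preimage continuous_snd)

theorem isOpen_vertex_rel (n : ℕ) (R : Vertex → Vertex → Prop) :
    IsOpen {p : Ray × Ray | R (p.1.vertex n) (p.2.vertex n)} := by
  have : {p : Ray × Ray | R (p.1.vertex n) (p.2.vertex n)} =
      ⋃ (x : Vertex) (y : Vertex) (_ : R x y),
        {ξ : Ray | ξ.vertex n = x} ×ˢ {η : Ray | η.vertex n = y} := by
    ext p
    simp
  rw [this]
  exact isOpen_iUnion fun x => isOpen_iUnion fun y => isOpen_iUnion fun _ =>
    (isOpen_vertex_eq n x).prod (isOpen_vertex_eq n y)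

theorem vertex_eq_of_le {ξ η : Ray} {m n : ℕ} (hmn : m ≤ n) (h : ξ.vertex n = η.vertex n) :
    ξ.vertex m = η.vertex m := by
  obtain ⟨j, rfl⟩ := Nat.exists_eq_add_of_le hmn
  rw [← iterate_vertex ξ j m, ← iterate_vertex η j m, h]

theorem meetDepth_eq {ξ η : Ray} {m : ℕ} (h₁ : ξ.vertex m = η.vertex m)
    (h₂ : ξ.vertex (m + 1) ≠ η.vertex (m + 1)) : meetDepth ξ η = m := by
  have hne : ξ ≠ η := by
    rintro rfl
    exact h₂ rfl
  refine le_antisymm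
    (Nat.sInf_le (s := {n | ξ.vertex (n + 1) ≠ η.vertex (n + 1)}) h₂) ?_
  by_contra! hlt
  exact vertex_meetDepth_ne hne (vertex_eq_of_le hlt h₁)

theorem mem_lineOf {p : {p : Ray × Ray // p.1 ≠ p.2}} {x : Vertex} :
    x ∈ lineOf p ↔ ∃ j : ℕ, x = p.1.1.vertex (meetDepth p.1.1 p.1.2 + j) ∨
      x = p.1.2.vertex (meetDepth p.1.1 p.1.2 + j) := by
  change x ∈ Set.range (joinPath p.1.1 p.1.2) ↔ _
  constructor
  · rintro ⟨k, rfl⟩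
    refine ⟨k.natAbs, ?_⟩
    rw [joinPath]
    split_ifs
    · exact Or.inr rfl
    · exact Or.inl rfl
  · rintro ⟨j, rfl | rfl⟩
    · refine ⟨-(j : ℤ), ?_⟩
      rw [joinPath]
      split_ifs with h
      · obtain rfl : j = 0 := by omega
        exact (vertex_meetDepth_eq _ _).symm
      · simp
    · refine ⟨j, ?_⟩
      rw [joinPath, if_pos (by omega)]
      simp

/-- In the final topology it suffices to look at pairs of rays. For a fixed meeting depth and a
fixed distance from the meeting point, the condition depends on finitely many letters, so it is
open. -/
theorem isOpen_setOf_mem (x : Vertex) : IsOpen {ℓ : Line | x ∈ ℓ} := by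
  rw [isOpen_coinduced]
  have : lineOf ⁻¹' {ℓ : Line | x ∈ ℓ} = ⋃ (m : ℕ) (j : ℕ), Subtype.val ⁻¹'
      ({p : Ray × Ray | p.1.vertex m = p.2.vertex m} ∩
        {p : Ray × Ray | p.1.vertex (m + 1) ≠ p.2.vertex (m + 1)} ∩
        {p : Ray × Ray | x = p.1.vertex (m + j) ∨ x = p.2.vertex (m + j)}) := by
    ext p
    simp only [Set.mem_preimage, Set.mem_ofPred_eq, mem_lineOf, Set.mem_iUnion, Set.mem_inter_iff]
    constructor
    · rintro ⟨j, hj⟩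
      exact ⟨_, j, ⟨vertex_meetDepth_eq _ _, vertex_meetDepth_ne p.2⟩, hj⟩
    · rintro ⟨m, j, ⟨h1, h2⟩, hj⟩
      rw [meetDepth_eq h1 h2]
      exact ⟨j, hj⟩
  rw [this]
  refine isOpen_iUnion fun m => isOpen_iUnion fun j => IsOpen.preimage continuous_subtype_val ?_
  exact ((isOpen_vertex_rel m fun a b => a = b).inter
    (isOpen_vertex_rel (m + 1) fun a b => a ≠ b)).inter
    (isOpen_vertex_rel (m + j) fun a b => x = a ∨ x = b)

theorem measurableSet_mem (x : Vertex) : MeasurableSet {ℓ : Line | x ∈ ℓ} :=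
  (isOpen_setOf_mem x).measurableSet

theorem measurable_lineOf : Measurable lineOf :=
  (continuous_coinduced_rng : Continuous lineOf).measurable

/-! ## The mass of the lines through two vertices -/

instance : IsProbabilityMeasure rayMeasure := by
  unfold rayMeasure
  infer_instance

theorem revPrefix_agree {b b' : ℕ → Fin 2} {n : ℕ} (h : revPrefix b n = revPrefix b' n) :
    ∀ i < n, b i = b' i := by
  induction n with
  | zero => simp
  | succ n ih =>
    simp only [revPrefix, List.cons.injEq] at h
    intro i hi
    rcases Nat.lt_succ_iff_lt_or_eq.1 hi with hi | rfl
    · exact ih h.2 i hi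
    · exact h.1

/-- Only the `n - 1` binary letters are used; the factor `2` absorbs the first step, whose
probability is bounded by `1`. -/
theorem rayMeasure_vertex_le (n : ℕ) (x : Vertex) :
    rayMeasure {ξ : Ray | ξ.vertex n = x} ≤ 2 * 2⁻¹ ^ n := by
  rcases n with _ | n
  · exact prob_le_one.trans (by norm_num)
  by_cases hx : ∃ η : Ray, η.vertex (n + 1) = x
  · obtain ⟨η, rfl⟩ := hx
    have hsub : {ξ : Ray | ξ.vertex (n + 1) = η.vertex (n + 1)} ⊆
        Set.univ ×ˢ (Finset.range n : Set ℕ).pi fun i => {η.2 i} := by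
      intro ξ hξ
      simp only [Ray.vertex, Set.mem_ofPred_eq, Option.some.injEq, Prod.mk.injEq] at hξ
      refine ⟨Set.mem_univ _, fun i hi => ?_⟩
      exact revPrefix_agree hξ.2 i (by simpa using hi)
    refine (measure_mono hsub).trans ?_
    rw [rayMeasure, Measure.prod_prod, Measure.infinitePi_pi _ (fun i _ => .of_discrete)]
    have h2 : ∀ a : Fin 2, uniformOn (Set.univ : Set (Fin 2)) {a} = 2⁻¹ := by
      intro a
      rw [uniformOn_univ]
      simp
    simp only [h2, measure_univ, one_mul, Finset.prod_const, Finset.card_range]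
    rw [pow_succ, mul_comm, mul_assoc, ENNReal.inv_mul_cancel (by norm_num) (by norm_num), mul_one]
  · have : {ξ : Ray | ξ.vertex (n + 1) = x} = ∅ := by
      ext ξ
      simp only [Set.mem_ofPred_eq, Set.mem_empty_iff_false, iff_false]
      exact fun h => hx ⟨ξ, h⟩
    rw [this]
    simp

/-- If one ray passes through `y` at depth `n` and the two rays agree up to depth `m ≤ n`, the other
passes through the ancestor `z` of `y` at depth `m`. Independence then gives a product, once for
each choice of the ray through `y`. -/
theorem prod_rayMeasure_meet_le (m n : ℕ) (hmn : m ≤ n) (y : Vertex) :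
    (rayMeasure.prod rayMeasure) {p : Ray × Ray | (p.1.vertex n = y ∨ p.2.vertex n = y) ∧
      p.1.vertex m = p.2.vertex m} ≤ 8 * 2⁻¹ ^ n * 2⁻¹ ^ m := by
  set z := parent^[n - m] y
  have hz : ∀ ξ : Ray, ξ.vertex n = y → ξ.vertex m = z := by
    rintro ξ rfl
    have := iterate_vertex ξ (n - m) m
    rw [Nat.add_sub_cancel' hmn] at this
    exact this.symm
  have hsub : {p : Ray × Ray | (p.1.vertex n = y ∨ p.2.vertex n = y) ∧
      p.1.vertex m = p.2.vertex m} ⊆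
      {ξ : Ray | ξ.vertex n = y} ×ˢ {η : Ray | η.vertex m = z} ∪
      {ξ : Ray | ξ.vertex m = z} ×ˢ {η : Ray | η.vertex n = y} := by
    rintro p ⟨h1 | h1, h2⟩
    · exact Or.inl ⟨h1, show p.2.vertex m = z by rw [← h2, hz _ h1]⟩
    · exact Or.inr ⟨show p.1.vertex m = z by rw [h2, hz _ h1], h1⟩
  refine (measure_mono hsub).trans ((measure_union_le _ _).trans ?_)
  rw [Measure.prod_prod, Measure.prod_prod]
  refine (add_le_add
    (mul_le_mul' (rayMeasure_vertex_le n y) (rayMeasure_vertex_le m z))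
    (mul_le_mul' (rayMeasure_vertex_le m z) (rayMeasure_vertex_le n y))).trans (le_of_eq ?_)
  ring

theorem ofReal_inv_rayDist_le (ξ η : Ray) :
    ENNReal.ofReal (1 / rayDist ξ η ^ 2) ≤ 4 ^ meetDepth ξ η := by
  by_cases h : ξ = η
  -- On the diagonal `rayDist` vanishes and `1 / 0 = 0`.
  · simp [rayDist, h]
  · rw [rayDist, if_neg h, ← pow_mul, mul_comm, pow_mul, one_div, ← inv_pow]
    norm_num

/-- The two rays separate at some depth `m ≤ depth x`, and one of them passes through `y`. This has
probability at most `8 * 2⁻¹ ^ depth y * 2⁻¹ ^ m`, while the density is `4 ^ m`; the sum over `m` is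
geometric and dominated by `m = depth x`. The constant `18 = 9 / 8 * 16` is not sharp, which is
harmless since it enters only through `δ`. -/
theorem lineMeasure_mem_le {x y : Vertex} (hxy : depth x < depth y) :
    lineMeasure {ℓ | x ∈ ℓ ∧ y ∈ ℓ} ≤ 18 * 2⁻¹ ^ (depth y - depth x) := by
  classical
  have hA : MeasurableSet {ℓ : Line | x ∈ ℓ ∧ y ∈ ℓ} :=
    (measurableSet_mem x).inter (measurableSet_mem y)
  have hoff : MeasurableSet {p : Ray × Ray | p.1 ≠ p.2} :=
    isClosed_diagonal.measurableSet.compl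
  have hemb : MeasurableEmbedding (Subtype.val : {p : Ray × Ray // p.1 ≠ p.2} → Ray × Ray) :=
    .subtype_coe hoff
  set E : Set (Ray × Ray) := Subtype.val '' (lineOf ⁻¹' {ℓ : Line | x ∈ ℓ ∧ y ∈ ℓ}) with hE
  have hEm : MeasurableSet E := hemb.measurableSet_image.2 (measurable_lineOf hA)
  let G : ℕ → Set (Ray × Ray) := fun m => {p | (p.1.vertex (depth y) = y ∨
    p.2.vertex (depth y) = y) ∧ p.1.vertex m = p.2.vertex m}
  have hG : ∀ m, MeasurableSet (G m) := fun m =>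
    ((isOpen_vertex_rel (depth y) fun a b => a = y ∨ b = y).inter
      (isOpen_vertex_rel m fun a b => a = b)).measurableSet
  have hpt : ∀ p : Ray × Ray, E.indicator (fun p => ENNReal.ofReal (1 / rayDist p.1 p.2 ^ 2)) p ≤
      ∑ m ∈ Finset.range (depth x + 1), (G m).indicator (fun _ => (4 : ℝ≥0∞) ^ m) p := by
    intro p
    by_cases hp : p ∈ E
    · obtain ⟨p, ⟨hx, hy⟩, rfl⟩ := hp
      rw [Set.indicator_of_mem (by exact ⟨p, ⟨hx, hy⟩, rfl⟩)]
      obtain ⟨i, hi⟩ := mem_lineOf.1 hx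
      obtain ⟨j, hj⟩ := mem_lineOf.1 hy
      have h1 : depth x = meetDepth p.1.1 p.1.2 + i := by
        rcases hi with h | h <;> rw [h, depth_vertex]
      have h2 : depth y = meetDepth p.1.1 p.1.2 + j := by
        rcases hj with h | h <;> rw [h, depth_vertex]
      have h3 : p.1 ∈ G (meetDepth p.1.1 p.1.2) := by
        refine ⟨?_, vertex_meetDepth_eq _ _⟩
        rw [h2]
        exact hj.imp Eq.symm Eq.symm
      refine (ofReal_inv_rayDist_le _ _).trans ?_
      have h4 := Finset.single_le_sum (f := fun m => (G m).indicator (fun _ => (4 : ℝ≥0∞) ^ m) p.1)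
        (s := Finset.range (depth x + 1)) (fun _ _ => zero_le)
        (Finset.mem_range.2 (show meetDepth p.1.1 p.1.2 < depth x + 1 by omega))
      rwa [Set.indicator_of_mem h3] at h4
    · rw [Set.indicator_of_notMem hp]
      exact zero_le
  have hI : ((rayMeasure.prod rayMeasure).withDensity
      fun p => ENNReal.ofReal (1 / rayDist p.1 p.2 ^ 2)) E ≤
      16 * 2⁻¹ ^ (depth y - depth x) := by
    rw [withDensity_apply _ hEm, ← lintegral_indicator hEm]
    refine (lintegral_mono hpt).trans ?_
    rw [lintegral_finsetSum _ fun m _ => measurable_const.indicator (hG m)]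
    have h1 : ∀ m ∈ Finset.range (depth x + 1),
        ∫⁻ p, (G m).indicator (fun _ => (4 : ℝ≥0∞) ^ m) p ∂(rayMeasure.prod rayMeasure) ≤
          8 * 2⁻¹ ^ depth y * 2 ^ m := by
      intro m hm
      rw [Finset.mem_range] at hm
      rw [lintegral_indicator_const (hG m)]
      refine (mul_le_mul_right (prod_rayMeasure_meet_le m (depth y) (by omega) y) _).trans
        (le_of_eq ?_)
      have : (4 : ℝ≥0∞) ^ m * 2⁻¹ ^ m = 2 ^ m := by
        rw [← mul_pow, show (4 : ℝ≥0∞) = 2 * 2 by norm_num, mul_assoc,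
          ENNReal.mul_inv_cancel (by norm_num) (by norm_num), mul_one]
      rw [← this]
      ring
    refine (Finset.sum_le_sum h1).trans ?_
    rw [← Finset.mul_sum]
    have h2 : ∑ m ∈ Finset.range (depth x + 1), (2 : ℝ≥0∞) ^ m ≤ 2 ^ (depth x + 1) := by
      have := Nat.geomSum_eq (m := 2) le_rfl (depth x + 1)
      have h3 : ∑ m ∈ Finset.range (depth x + 1), 2 ^ m ≤ 2 ^ (depth x + 1) := by
        rw [this]
        simp
      exact_mod_cast h3
    refine (mul_le_mul_right h2 _).trans (le_of_eq ?_)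
    obtain ⟨d, hd⟩ := Nat.exists_eq_add_of_le hxy.le
    rw [hd, Nat.add_sub_cancel_left, pow_add, pow_succ]
    have : (2⁻¹ : ℝ≥0∞) ^ depth x * 2 ^ depth x = 1 := by
      rw [← mul_pow, ENNReal.inv_mul_cancel (by norm_num) (by norm_num), one_pow]
    calc 8 * ((2⁻¹ : ℝ≥0∞) ^ depth x * 2⁻¹ ^ d) * (2 ^ depth x * 2)
        = 16 * (2⁻¹ ^ depth x * 2 ^ depth x) * 2⁻¹ ^ d := by ring
      _ = 16 * 2⁻¹ ^ d := by rw [this, mul_one]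
  rw [lineMeasure, Measure.smul_apply, Measure.map_apply measurable_lineOf hA, hemb.comap_apply,
    smul_eq_mul]
  refine (mul_le_mul_right hI _).trans (le_of_eq ?_)
  rw [← mul_assoc]
  congr 1
  rw [ENNReal.div_eq_inv_mul, mul_assoc, show (9 : ℝ≥0∞) * 16 = 8 * 18 by norm_num, ← mul_assoc,
    ENNReal.inv_mul_cancel (by norm_num) (by norm_num), one_mul]

/-! ## Roads that use a given interval of a path -/

theorem lintegral_rpow_le {β a : ℝ} (hβ : 1 < β) (ha : 0 < a) :
    ((Measure.comap Subtype.val (volume : Measure ℝ)).withDensity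
      fun v : Set.Ioi (0 : ℝ) => ENNReal.ofReal ((v : ℝ) ^ (-β))) {v | a ≤ v} ≤
      ENNReal.ofReal (a ^ (1 - β) / (β - 1)) := by
  have hm : MeasurableSet {v : Set.Ioi (0 : ℝ) | a ≤ v} :=
    measurableSet_le measurable_const measurable_subtype_coe
  rw [withDensity_apply _ hm, ← lintegral_indicator hm]
  have h1 : ∀ v : Set.Ioi (0 : ℝ), {v : Set.Ioi (0 : ℝ) | a ≤ v}.indicator
      (fun v => ENNReal.ofReal ((v : ℝ) ^ (-β))) v =
      (Set.Ici a).indicator (fun v => ENNReal.ofReal (v ^ (-β))) (v : ℝ) := by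
    intro v
    simp [Set.indicator_apply]
  simp only [h1]
  rw [lintegral_subtype_comap measurableSet_Ioi
    ((Set.Ici a).indicator (fun v => ENNReal.ofReal (v ^ (-β))))]
  refine (setLIntegral_le_lintegral _ _).trans ?_
  rw [lintegral_indicator measurableSet_Ici, setLIntegral_congr Ioi_ae_eq_Ici.symm,
    ← ofReal_integral_eq_lintegral_ofReal (integrableOn_Ioi_rpow_of_lt (by linarith) ha),
    integral_Ioi_rpow_of_lt (by linarith) ha]
  · refine ENNReal.ofReal_le_ofReal (le_of_eq ?_)
    rw [show -β + 1 = -(β - 1) by ring, neg_div_neg_eq, neg_sub]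
  · filter_upwards [ae_restrict_mem measurableSet_Ioi] with v hv
    exact Real.rpow_nonneg (ha.trans hv).le _

theorem roadIntensity_le {β a : ℝ} (hβ : 1 < β) (ha : 0 < a) {x y : Vertex}
    (hxy : depth x < depth y) :
    roadIntensity β ({ℓ : Line | x ∈ ℓ ∧ y ∈ ℓ} ×ˢ {v : Set.Ioi (0 : ℝ) | a ≤ v}) ≤
      18 * 2⁻¹ ^ (depth y - depth x) * ENNReal.ofReal (a ^ (1 - β)) := by
  rw [roadIntensity, Measure.smul_apply, smul_eq_mul]
  refine (mul_le_mul_right ((Measure.prod_prod_le _ _).trans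
    (mul_le_mul' (lineMeasure_mem_le hxy) (lintegral_rpow_le hβ ha))) _).trans (le_of_eq ?_)
  rw [mul_left_comm, ← ENNReal.ofReal_mul (by linarith), mul_div_cancel₀ _ (by linarith)]

/-- The roads whose first vertex on the path `x 0, …, x n` is `x i`, whose last one is `x j`, and
whose speed is in `[2 ^ k τ, 2 ^ (k + 1) τ)`, or in `[2 ^ n τ, ∞)` if `k = n`. -/
def roadClass (x : ℕ → Vertex) (n : ℕ) (τ : ℝ) (c : Fin (n + 1) × Fin (n + 1) × Fin (n + 1)) :
    Set Road :=
  {r | (x c.1 ∈ r.1 ∧ x c.2.1 ∈ r.1) ∧ (∀ m, m < (c.1 : ℕ) → x m ∉ r.1) ∧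
    (∀ m, (c.2.1 : ℕ) < m → m ≤ n → x m ∉ r.1) ∧
    2 ^ (c.2.2 : ℕ) * τ ≤ r.2 ∧ ((c.2.2 : ℕ) < n → (r.2 : ℝ) < 2 ^ ((c.2.2 : ℕ) + 1) * τ)}

theorem measurableSet_roadClass (x : ℕ → Vertex) (n : ℕ) (τ : ℝ)
    (c : Fin (n + 1) × Fin (n + 1) × Fin (n + 1)) : MeasurableSet (roadClass x n τ c) := by
  have hm : ∀ y : Vertex, MeasurableSet {r : Road | y ∈ r.1} := fun y =>
    measurable_fst (measurableSet_mem y)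
  have hv : Measurable fun r : Road => (r.2 : ℝ) := measurable_subtype_coe.comp measurable_snd
  refine ((hm _).inter (hm _)).inter (.inter ?_ (.inter ?_ (.inter ?_ ?_)))
  · have : {r : Road | ∀ m, m < (c.1 : ℕ) → x m ∉ r.1} =
        ⋂ (m : ℕ) (_ : m < (c.1 : ℕ)), {r : Road | x m ∈ r.1}ᶜ := by
      ext r
      simp
    change MeasurableSet {r : Road | _}
    rw [this]
    exact .iInter fun m => .iInter fun _ => (hm _).compl
  · have : {r : Road | ∀ m, (c.2.1 : ℕ) < m → m ≤ n → x m ∉ r.1} =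
        ⋂ (m : ℕ) (_ : (c.2.1 : ℕ) < m) (_ : m ≤ n), {r : Road | x m ∈ r.1}ᶜ := by
      ext r
      simp
    change MeasurableSet {r : Road | _}
    rw [this]
    exact .iInter fun m => .iInter fun _ => .iInter fun _ => (hm _).compl
  · exact measurableSet_le measurable_const hv
  · by_cases h : (c.2.2 : ℕ) < n
    · simp only [h, forall_const]
      exact measurableSet_lt hv measurable_const
    · simp only [h, false_imp_iff]
      exact MeasurableSet.univ

theorem disjoint_roadClass (x : ℕ → Vertex) (n : ℕ) {τ : ℝ} (hτ : 0 < τ) :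
    Pairwise (Function.onFun Disjoint (roadClass x n τ)) := by
  intro c c' hne
  rw [Function.onFun, Set.disjoint_left]
  rintro r ⟨⟨h1, h2⟩, h3, h4, h5, h6⟩ ⟨⟨h1', h2'⟩, h3', h4', h5', h6'⟩
  apply hne
  have hlev : ∀ k k' : Fin (n + 1), 2 ^ (k : ℕ) * τ ≤ r.2 →
      ((k' : ℕ) < n → (r.2 : ℝ) < 2 ^ ((k' : ℕ) + 1) * τ) → (k : ℕ) ≤ k' := by
    intro k k' hk hk'
    -- If `k' < k` then `k'` is not the top level `n`, so its upper speed bound is in force.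
    by_contra! hlt
    have := hk.trans_lt (hk' (by have := k.2; omega))
    have h := lt_of_mul_lt_mul_right this hτ.le
    have := (pow_lt_pow_iff_right₀ (by norm_num : (1 : ℝ) < 2)).1 h
    omega
  have e1 : (c.1 : ℕ) = c'.1 := by
    rcases lt_trichotomy (c.1 : ℕ) c'.1 with h | h | h
    · exact absurd h1 (h3' _ h)
    · exact h
    · exact absurd h1' (h3 _ h)
  have e2 : (c.2.1 : ℕ) = c'.2.1 := by
    rcases lt_trichotomy (c.2.1 : ℕ) c'.2.1 with h | h | h
    · exact absurd h2' (h4 _ h (by have := c'.2.1.2; omega))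
    · exact h
    · exact absurd h2 (h4' _ h (by have := c.2.1.2; omega))
  have e3 := le_antisymm (hlev _ _ h5 h6') (hlev _ _ h5' h6)
  exact Prod.ext (Fin.ext e1) (Prod.ext (Fin.ext e2) (Fin.ext e3))

theorem exists_roadClass {x : ℕ → Vertex} {n e : ℕ} (he : e < n) {τ : ℝ} (hτ : 0 < τ) {r : Road}
    (h₁ : x e ∈ r.1) (h₂ : x (e + 1) ∈ r.1) (hv : τ ≤ r.2) :
    ∃ c, r ∈ roadClass x n τ c ∧ Covers c e := by
  classical
  let A := (Finset.range (n + 1)).filter fun m => x m ∈ r.1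
  have hA : ∀ m, m ∈ A ↔ m < n + 1 ∧ x m ∈ r.1 := fun m => by simp [A]
  have he₁ : e ∈ A := (hA e).2 ⟨by omega, h₁⟩
  have he₂ : e + 1 ∈ A := (hA _).2 ⟨by omega, h₂⟩
  obtain ⟨i, hi, hmin⟩ := A.exists_min_image id ⟨e, he₁⟩
  obtain ⟨j, hj, hmax⟩ := A.exists_max_image id ⟨e, he₁⟩
  obtain ⟨hi₁, hi₂⟩ := (hA i).1 hi
  obtain ⟨hj₁, hj₂⟩ := (hA j).1 hj
  obtain ⟨k, hk₁, hk₂⟩ := exists_nat_pow_near (x := (r.2 : ℝ) / τ) (y := 2)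
    (by rwa [le_div_iff₀ hτ, one_mul]) (by norm_num)
  rw [le_div_iff₀ hτ] at hk₁
  rw [div_lt_iff₀ hτ] at hk₂
  refine ⟨(⟨i, hi₁⟩, ⟨j, hj₁⟩, ⟨min k n, by omega⟩), ⟨⟨hi₂, hj₂⟩, ?_, ?_, ?_, ?_⟩, ?_⟩
  · intro m hm h
    have := hmin m ((hA m).2 ⟨by simp only at hm; omega, h⟩)
    simp only [id] at this hm
    omega
  · intro m hm hmn h
    have := hmax m ((hA m).2 ⟨by omega, h⟩)
    simp only [id] at this hm
    omega
  · refine le_trans (mul_le_mul_of_nonneg_right ?_ hτ.le) hk₁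
    exact pow_le_pow_right₀ (by norm_num) (min_le_left _ _)
  · intro h
    simp only at h ⊢
    rwa [min_eq_left (by omega)]
  · have h3 := hmin e he₁
    have h4 := hmax (e + 1) he₂
    simp only [id] at h3 h4
    exact ⟨h3, by simp only; omega⟩

/-- The passage time of the path `x 0, …, x n`. -/
noncomputable def pathTime (π : Measure Road) (x : ℕ → Vertex) (n : ℕ) : ℝ≥0∞ :=
  ∑ i ∈ Finset.range n, (speed π (x i) (x (i + 1)))⁻¹

theorem slowEdges_subset {N : ℕ} (S : Set (Fin N × Fin N × Fin N)) (s n k : ℕ) :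
    slowEdges S s n k ⊆ Finset.Ico s n := by
  classical
  exact Finset.filter_subset _ _

/-- An edge with only covers of level at most `k < n` has speed at most `2 ^ (k + 1) / (2 * t)`, so
it costs at least `t / 2 ^ k`; a total of at most `t` allows only `2 ^ k` of them. -/
theorem fastCover_of_pathTime_le {π : Measure Road} {x : ℕ → Vertex} {n : ℕ} {t : ℝ} (ht : 0 < t)
    (h : pathTime π x n ≤ ENNReal.ofReal t) :
    FastCover {c | π (roadClass x n (1 / (2 * t)) c) ≠ 0} 0 n := by
  classical
  set τ := 1 / (2 * t) with hτt
  have hτ : 0 < τ := by positivity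
  have hcls : ∀ e < n, ∀ r : Road, π {r} ≠ 0 → x e ∈ r.1 ∧ x (e + 1) ∈ r.1 → τ ≤ r.2 →
      ∃ c, π (roadClass x n τ c) ≠ 0 ∧ r ∈ roadClass x n τ c ∧ Covers c e := by
    intro e he r hr hx hv
    obtain ⟨c, h1, h2⟩ := exists_roadClass he hτ hx.1 hx.2 hv
    exact ⟨c, fun h0 => hr (measure_mono_null (Set.singleton_subset_iff.2 h1) h0), h1, h2⟩
  constructor
  · intro e _ he
    have h1 : (speed π (x e) (x (e + 1)))⁻¹ ≤ ENNReal.ofReal t :=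
      (Finset.single_le_sum (f := fun i => (speed π (x i) (x (i + 1)))⁻¹) (fun _ _ => zero_le)
        (Finset.mem_range.2 he)).trans h
    -- The factor `2` in `τ` makes this strict, so that some actual road beats `τ` even if the
    -- supremum is not attained.
    have h2 : ENNReal.ofReal τ < speed π (x e) (x (e + 1)) := by
      refine lt_of_lt_of_le ?_ (ENNReal.inv_le_iff_inv_le.1 h1)
      rw [← ENNReal.ofReal_inv_of_pos ht]
      refine (ENNReal.ofReal_lt_ofReal_iff (by positivity)).2 ?_
      rw [hτt, one_div]
      exact inv_strictAnti₀ ht (by linarith)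
    simp only [speed, lt_iSup_iff] at h2
    obtain ⟨r, hr, hx, hv⟩ := h2
    obtain ⟨c, h3, _, h5⟩ := hcls e he r hr hx (ENNReal.ofReal_lt_ofReal_iff r.2.2 |>.1 hv).le
    exact ⟨c, h3, h5⟩
  · intro k
    rcases le_or_gt n k with hk | hk
    · have h1 : (slowEdges {c | π (roadClass x n τ c) ≠ 0} 0 n k).card ≤ n := by
        refine (Finset.card_le_card (slowEdges_subset _ _ _ _)).trans ?_
        simp
      exact h1.trans (hk.trans Nat.lt_two_pow_self.le)
    set F := slowEdges {c | π (roadClass x n τ c) ≠ 0} 0 n k with hF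
    have hslow : ∀ e ∈ F, ENNReal.ofReal (t / 2 ^ k) ≤ (speed π (x e) (x (e + 1)))⁻¹ := by
      intro e he
      simp only [hF, slowEdges, Finset.mem_filter, Finset.mem_Ico] at he
      have h1 : speed π (x e) (x (e + 1)) ≤ ENNReal.ofReal (2 ^ (k + 1) * τ) := by
        refine iSup_le fun r => iSup_le fun hr => iSup_le fun hx => ENNReal.ofReal_le_ofReal ?_
        -- Roads slower than `τ` belong to no class, but they satisfy the speed bound trivially.
        rcases le_total τ r.2 with hv | hv
        · obtain ⟨c, h3, h4, h5⟩ := hcls e he.1.2 r hr hx hv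
          have h6 := he.2 c h3 h5
          refine (h4.2.2.2.2 (by omega)).le.trans (mul_le_mul_of_nonneg_right ?_ hτ.le)
          exact pow_le_pow_right₀ (by norm_num) (by omega)
        · exact hv.trans (le_mul_of_one_le_left hτ.le (one_le_pow₀ (by norm_num)))
      refine le_trans (le_of_eq ?_) (ENNReal.inv_le_inv.2 h1)
      rw [← ENNReal.ofReal_inv_of_pos (by positivity), hτt]
      congr 1
      field_simp
      ring
    have hsum : (F.card : ℝ≥0∞) * ENNReal.ofReal (t / 2 ^ k) ≤ ENNReal.ofReal t := by
      refine le_trans ?_ h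
      rw [← nsmul_eq_mul, ← Finset.sum_const]
      refine (Finset.sum_le_sum hslow).trans (Finset.sum_le_sum_of_subset ?_)
      intro e he
      simp only [hF, slowEdges, Finset.mem_filter, Finset.mem_Ico] at he
      exact Finset.mem_range.2 he.1.2
    rw [← ENNReal.ofReal_natCast, ← ENNReal.ofReal_mul (by positivity),
      ENNReal.ofReal_le_ofReal_iff ht.le, mul_div_assoc', div_le_iff₀ (by positivity), mul_comm]
      at hsum
    exact_mod_cast le_of_mul_le_mul_left hsum ht

/-! ## Counts of a Poisson process -/

theorem poissonMeasure_ne_zero_le (r : ℝ≥0) : poissonMeasure r {k | k ≠ 0} ≤ r := by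
  have h0 : {k : ℕ | k ≠ 0} = {0}ᶜ := rfl
  rw [h0, prob_compl_eq_one_sub (.of_discrete), poissonMeasure_singleton]
  simp only [pow_zero, mul_one, Nat.factorial_zero, Nat.cast_one, div_one]
  rw [← ENNReal.ofReal_one, ← ENNReal.ofReal_sub _ (Real.exp_pos _).le, ← ENNReal.ofReal_coe_nnreal]
  refine ENNReal.ofReal_le_ofReal ?_
  linarith [Real.add_one_le_exp (-(r : ℝ))]

section Poisson

variable {Ω S : Type*} [MeasurableSpace Ω] [MeasurableSpace S] {P : Measure Ω}
  {ν : Measure S} {N : Ω → Measure S}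

theorem IsPoissonProcess.measurable_count (h : IsPoissonProcess P ν N) {B : Set S}
    (hB : MeasurableSet B) : Measurable fun ω => N ω B :=
  (Measure.measurable_coe hB).comp h.measurable

theorem IsPoissonProcess.measure_ne_zero_le (h : IsPoissonProcess P ν N) {B : Set S}
    (hB : MeasurableSet B) : P {ω | N ω B ≠ 0} ≤ ν B := by
  by_cases hν : ν B = ∞
  · rw [hν]
    exact le_top
  have hs : MeasurableSet ({0}ᶜ : Set ℝ≥0∞) := (measurableSet_singleton _).compl
  have h1 := congrArg (fun m : Measure ℝ≥0∞ => m {0}ᶜ) (h.law_of_ne_top B hB hν)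
  rw [Measure.map_apply (h.measurable_count hB) hs, Measure.map_apply .of_discrete hs] at h1
  have h2 : (fun ω => N ω B) ⁻¹' {0}ᶜ = {ω | N ω B ≠ 0} := rfl
  have h3 : (fun k : ℕ => (k : ℝ≥0∞)) ⁻¹' {0}ᶜ = {k | k ≠ 0} := by
    ext k
    simp
  rw [← h2, h1, h3]
  exact (poissonMeasure_ne_zero_le _).trans (by rw [ENNReal.coe_toNNReal hν])

theorem IsPoissonProcess.iIndepFun_ne_zero (h : IsPoissonProcess P ν N) {ι : Type*} [Fintype ι]
    {B : ι → Set S} (hB : ∀ i, MeasurableSet (B i)) (hd : Pairwise (Function.onFun Disjoint B)) :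
    iIndepFun (fun i ω => N ω (B i) ≠ 0) P := by
  have e := Fintype.equivFin ι
  have h1 := h.indep (Fintype.card ι) (fun i => B (e.symm i)) (fun i => hB _)
    (fun i j hij => hd (e.symm.injective.ne hij))
  have h2 := h1.precomp e.injective
  simp only [Equiv.symm_apply_apply] at h2
  have hm : Measurable fun a : ℝ≥0∞ => a ≠ 0 :=
    measurableSet_setOfPred.1 (measurableSet_singleton (0 : ℝ≥0∞)).compl
  exact h2.comp (fun _ a => a ≠ 0) fun _ => hm

end Poisson

/-! ## The passage time of a downward path -/

section Passage

variable {Ω : Type*} [MeasurableSpace Ω] {P : Measure Ω} [IsProbabilityMeasure P]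
  {N : Ω → Measure Road} {β : ℝ}

/-- The ratio of the intensities of two successive speed levels. -/
noncomputable def levelRatio (β : ℝ) : ℝ≥0 := (2 : ℝ≥0) ^ (1 - β)

/-- The intensity of the roads of speed at least `1 / (2 t)`, up to the factor given by the
length. -/
noncomputable def roadRate (β t : ℝ) : ℝ≥0 := 18 * Real.toNNReal (1 / (2 * t)) ^ (1 - β)

theorem measure_pathTime_le (hN : IsPoissonProcess P (roadIntensity β) N) (hβ : 2 < β) {t : ℝ}
    (ht : 0 < t) (hδ : (roadRate β t : ℝ) ≤ 1 / 128) {x : ℕ → Vertex} {n d : ℕ}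
    (hx : ∀ i ≤ n, depth (x i) = d + i) :
    P {ω | pathTime (N ω) x n ≤ ENNReal.ofReal t} ≤
      2⁻¹ ^ n * renewal (coverWeight (roadRate β t) (levelRatio β)) n := by
  have hτ : 0 < 1 / (2 * t) := by positivity
  have hB := measurableSet_roadClass x n (1 / (2 * t))
  have hX : ∀ c, Measurable fun ω => N ω (roadClass x n (1 / (2 * t)) c) ≠ 0 := fun c =>
    measurableSet_setOfPred.1 (hN.measurable_count (hB c) (measurableSet_singleton 0).compl)
  have hi := hN.iIndepFun_ne_zero hB (disjoint_roadClass x n hτ)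
  have hp : ∀ c : Fin (n + 1) × Fin (n + 1) × Fin (n + 1), (c.1 : ℕ) < c.2.1 →
      P {ω | N ω (roadClass x n (1 / (2 * t)) c) ≠ 0} ≤
        ((roadRate β t * 2⁻¹ ^ ((c.2.1 : ℕ) - c.1) * levelRatio β ^ (c.2.2 : ℕ) : ℝ≥0) : ℝ≥0∞) := by
    intro c hc
    have h1 := hx c.1 (by have := c.1.2; omega)
    have h2 := hx c.2.1 (by have := c.2.1.2; omega)
    have hsub : roadClass x n (1 / (2 * t)) c ⊆ {ℓ : Line | x c.1 ∈ ℓ ∧ x c.2.1 ∈ ℓ} ×ˢ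
        {v : Set.Ioi (0 : ℝ) | 2 ^ (c.2.2 : ℕ) * (1 / (2 * t)) ≤ v} := fun r hr => ⟨hr.1, hr.2.2.2.1⟩
    refine (hN.measure_ne_zero_le (hB c)).trans ((measure_mono hsub).trans
      ((roadIntensity_le (by linarith) (by positivity) (by rw [h1, h2]; omega)).trans (le_of_eq ?_)))
    rw [h1, h2, Nat.add_sub_add_left, Real.mul_rpow (by positivity) hτ.le,
      ENNReal.ofReal_mul (by positivity)]
    have e1 : ENNReal.ofReal ((1 / (2 * t)) ^ (1 - β)) =
        ((Real.toNNReal (1 / (2 * t)) ^ (1 - β) : ℝ≥0) : ℝ≥0∞) := by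
      rw [ENNReal.ofReal, Real.toNNReal_rpow_of_nonneg hτ.le]
    have e2 : ENNReal.ofReal (((2 : ℝ) ^ (c.2.2 : ℕ)) ^ (1 - β)) =
        ((levelRatio β ^ (c.2.2 : ℕ) : ℝ≥0) : ℝ≥0∞) := by
      rw [ENNReal.ofReal, Real.toNNReal_rpow_of_nonneg (by positivity), levelRatio,
        Real.toNNReal_pow (by norm_num)]
      congr 1
      rw [← NNReal.rpow_natCast, ← NNReal.rpow_natCast, ← NNReal.rpow_mul, ← NNReal.rpow_mul,
        mul_comm]
      simp
    rw [e1, e2, roadRate]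
    push_cast
    ring
  have hq : (levelRatio β : ℝ) ≤ 1 / 2 := by
    rw [levelRatio, NNReal.coe_rpow, one_div, ← Real.rpow_neg_one]
    exact Real.rpow_le_rpow_of_exponent_le (by norm_num) (by linarith)
  have := measure_fastCover_le hX hi hp hq hδ n 0
  rw [zero_add] at this
  exact (measure_mono fun ω hω => fastCover_of_pathTime_le ht hω).trans this

end Passage

/-! ## Measurability of the speeds -/

/-- Passes from counts of measurable sets to the atoms in the definition of `speed`. Singletons need
not be measurable here, so the proof uses only lower bounds for `Measure.sum` and `Measure.dirac`
that hold for every set. -/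
theorem exists_atom_of_ne_zero {S : Type*} [MeasurableSpace S] {π : Measure S} (hπ : IsAtomic π)
    {B : Set S} (hB : MeasurableSet B) (h : π B ≠ 0) : ∃ r ∈ B, π {r} ≠ 0 := by
  obtain ⟨n, s, rfl⟩ := hπ
  rw [Measure.sum_apply _ hB] at h
  obtain ⟨k, hk⟩ : ∃ k, Measure.dirac (s k) B ≠ 0 := by
    by_contra! H
    exact h (by simp [H])
  have hs : s k ∈ B := by
    rw [Measure.dirac_apply' _ hB] at hk
    exact Set.mem_of_indicator_ne_zero hk
  refine ⟨s k, hs, fun h0 => ?_⟩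
  have h1 := (Measure.le_sum (fun k => Measure.dirac (s k)) k {s k}).trans_eq h0
  have h2 := (Measure.le_dirac_apply (s := {s k}) (a := s k)).trans h1
  simp at h2

/-- The supremum over roads is uncountable, but the speed exceeds `a` exactly when the process
charges a measurable set of roads, because a charged set contains an atom. -/
theorem measurable_speed {Ω : Type*} [MeasurableSpace Ω] {N : Ω → Measure Road}
    (hN : Measurable N) (ha : ∀ ω, IsAtomic (N ω)) (x y : Vertex) :
    Measurable fun ω => speed (N ω) x y := by
  refine measurable_of_Ioi fun a => ?_
  let B : Set Road := {r | (x ∈ r.1 ∧ y ∈ r.1) ∧ a < ENNReal.ofReal (r.2 : ℝ)}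
  have hB : MeasurableSet B := by
    have hv : Measurable fun r : Road => ENNReal.ofReal (r.2 : ℝ) :=
      (measurable_subtype_coe.comp measurable_snd).ennreal_ofReal
    exact ((measurable_fst (measurableSet_mem x)).inter
      (measurable_fst (measurableSet_mem y))).inter (hv measurableSet_Ioi)
  have : (fun ω => speed (N ω) x y) ⁻¹' Set.Ioi a = (fun ω => N ω B) ⁻¹' {0}ᶜ := by
    ext ω
    simp only [Set.mem_preimage, Set.mem_Ioi, Set.mem_compl_iff, Set.mem_singleton_iff, speed,
      lt_iSup_iff]
    constructor
    · rintro ⟨r, hr, hx, hv⟩ h0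
      exact hr (measure_mono_null (Set.singleton_subset_iff.2 (show r ∈ B from ⟨hx, hv⟩)) h0)
    · intro h
      obtain ⟨r, ⟨hx, hv⟩, hr⟩ := exists_atom_of_ne_zero (ha ω) hB h
      exact ⟨r, hr, hx, hv⟩
  rw [this]
  exact ((Measure.measurable_coe hB).comp hN) (measurableSet_singleton 0).compl

/-! ## Geodesics from the root -/

/-- The ancestor of `x` at distance `i` from the ancestor at depth `d`. -/
def ancestor (d : ℕ) (x : Vertex) (i : ℕ) : Vertex := parent^[depth x - d - i] x

theorem depth_ancestor {d i : ℕ} {x : Vertex} (hd : d ≤ depth x) (hi : i ≤ depth x - d) :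
    depth (ancestor d x i) = d + i := by
  rw [ancestor, depth_iterate]
  omega

/-- The passage time from the ancestor of `x` at depth `d` down to `x`. -/
noncomputable def descentTime (π : Measure Road) (d : ℕ) (x : Vertex) : ℝ≥0∞ :=
  pathTime π (ancestor d x) (depth x - d)

theorem geodesic_eq {x y : Vertex} {p : tree.Walk x y} (hp : p.IsPath) : geodesic x y = p :=
  (tree_isTree.existsUnique_path x y).unique (tree_isTree.existsUnique_path x y).choose_spec.1 hp

theorem drivingDist_eq_of_isPath (π : Measure Road) {x y : Vertex} {p : tree.Walk x y}
    (hp : p.IsPath) :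
    drivingDist π x y = (p.darts.map fun e => (speed π e.fst e.snd)⁻¹).sum := by
  rw [drivingDist, geodesic_eq hp]

theorem exists_rootPath (π : Measure Road) (n : ℕ) (x : Vertex) (hx : depth x = n) :
    -- The bound on depths along the support is carried through the induction because it keeps the
    -- walk extended to `x` a path.
    ∃ p : tree.Walk root x, p.IsPath ∧ p.length = n ∧ (∀ v ∈ p.support, depth v ≤ n) ∧
      (p.darts.map fun e => (speed π e.fst e.snd)⁻¹).sum = descentTime π 0 x := by
  induction n generalizing x with
  | zero =>
    obtain rfl : x = root := by
      by_contra h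
      have := depth_pos h
      omega
    exact ⟨.nil, by simp, rfl, by simp [depth], by simp [descentTime, pathTime, depth]⟩
  | succ n ih =>
    have hne : x ≠ root := by
      rintro rfl
      simp [depth] at hx
    have hpar : depth (parent x) = n := by rw [depth_parent, hx, Nat.add_sub_cancel]
    obtain ⟨p, h1, h2, h3, h4⟩ := ih (parent x) hpar
    refine ⟨p.concat (adj_parent hne).symm, ?_, ?_, ?_, ?_⟩
    · refine h1.concat (fun h => ?_) _
      have := h3 x h
      omega
    · rw [SimpleGraph.Walk.length_concat, h2]
    · intro v hv
      rw [SimpleGraph.Walk.support_concat] at hv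
      simp only [List.mem_append, List.mem_singleton] at hv
      rcases hv with hv | rfl
      · exact (h3 v hv).trans (Nat.le_succ n)
      · exact hx.le
    · rw [SimpleGraph.Walk.darts_concat, List.concat_eq_append, List.map_append, List.sum_append,
        h4]
      simp only [List.map_cons, List.map_nil, List.sum_cons, List.sum_nil, add_zero, descentTime,
        pathTime, hx, hpar, Nat.sub_zero, Finset.sum_range_succ]
      congr 1
      · refine Finset.sum_congr rfl fun i hi => ?_
        rw [Finset.mem_range] at hi
        have key : ∀ j ≤ n, ancestor 0 x j = ancestor 0 (parent x) j := by
          intro j hj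
          rw [ancestor, ancestor, hx, hpar, ← Function.iterate_succ_apply]
          congr 2
          omega
        rw [key i hi.le, key (i + 1) hi]
      · have e1 : ancestor 0 x n = parent x := by simp [ancestor, hx]
        have e2 : ancestor 0 x (n + 1) = x := by simp [ancestor, hx]
        rw [e1, e2]

theorem drivingDist_root (π : Measure Road) (x : Vertex) :
    drivingDist π root x = descentTime π 0 x := by
  obtain ⟨p, h1, -, -, h4⟩ := exists_rootPath π _ x rfl
  rw [drivingDist_eq_of_isPath π h1, h4]

theorem dist_root (x : Vertex) : tree.dist root x = depth x := by
  obtain ⟨p, h1, h2, -, -⟩ := exists_rootPath 0 _ x rfl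
  obtain ⟨q, hq, hq'⟩ := tree_connected.exists_path_of_dist root x
  rw [← hq', ← geodesic_eq hq, geodesic_eq h1, h2]

theorem drivingDist_of_adj (π : Measure Road) {x y : Vertex} (h : tree.Adj x y) :
    drivingDist π x y = (speed π x y)⁻¹ := by
  have hp : (SimpleGraph.Walk.cons h .nil).IsPath := by
    simp [h.ne]
  rw [drivingDist_eq_of_isPath π hp]
  simp

theorem IsGeodesicRay.depth_eq {x : ℕ → Vertex} (hx : IsGeodesicRay x) (n : ℕ) :
    depth (x n) = n := by
  have := hx.2 0 n
  rw [hx.1, dist_root] at this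
  simpa using this

theorem IsGeodesicRay.adj {x : ℕ → Vertex} (hx : IsGeodesicRay x) (n : ℕ) :
    tree.Adj (x n) (x (n + 1)) := by
  rw [← SimpleGraph.dist_eq_one_iff_adj]
  have := hx.2 n (n + 1)
  push_cast at this
  rw [sub_add_cancel_left, abs_neg, abs_one] at this
  exact_mod_cast this

theorem IsGeodesicRay.parent_eq {x : ℕ → Vertex} (hx : IsGeodesicRay x) (n : ℕ) :
    parent (x (n + 1)) = x n := by
  rcases (tree_adj.1 (hx.adj n)).2 with h | h
  · have := depth_parent (x n)
    rw [h, hx.depth_eq, hx.depth_eq] at this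
    omega
  · exact h

theorem IsGeodesicRay.iterate_parent {x : ℕ → Vertex} (hx : IsGeodesicRay x) (j n : ℕ) :
    parent^[j] (x (n + j)) = x n := by
  induction j with
  | zero => rfl
  | succ j ih => rw [Function.iterate_succ_apply, ← add_assoc, hx.parent_eq, ih]

theorem IsGeodesicRay.descentTime_eq {x : ℕ → Vertex} (hx : IsGeodesicRay x) (π : Measure Road)
    (d m : ℕ) : descentTime π d (x (d + m)) =
      ∑ i ∈ Finset.range m, drivingDist π (x (i + d)) (x (i + d + 1)) := by
  have key : ∀ i ≤ m, ancestor d (x (d + m)) i = x (i + d) := by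
    intro i hi
    rw [ancestor, hx.depth_eq, ← hx.iterate_parent (d + m - d - i) (i + d)]
    congr 2
    omega
  rw [descentTime, pathTime, hx.depth_eq, Nat.add_sub_cancel_left]
  refine Finset.sum_congr rfl fun i hi => ?_
  rw [Finset.mem_range] at hi
  rw [key i hi.le, key (i + 1) hi, drivingDist_of_adj π (hx.adj _),
    show i + 1 + d = i + d + 1 by omega]

/-! ## Sums over the tree -/

theorem tsum_list_length (f : ℕ → ℝ≥0∞) :
    ∑' w : List (Fin 2), f w.length = ∑' n, 2 ^ n * f n := by
  rw [← (Equiv.sigmaFiberEquiv (List.length (α := Fin 2))).tsum_eq, ENNReal.tsum_sigma']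
  refine tsum_congr fun n => ?_
  have h : ∀ w : {w : List (Fin 2) // w.length = n},
      f ((Equiv.sigmaFiberEquiv (List.length (α := Fin 2))) ⟨n, w⟩).length = f n := by
    rintro ⟨w, rfl⟩
    rfl
  simp only [h]
  have : Fintype {w : List (Fin 2) // w.length = n} :=
    inferInstanceAs (Fintype (List.Vector (Fin 2) n))
  have hcard : Fintype.card {w : List (Fin 2) // w.length = n} = 2 ^ n := by
    have h2 := card_vector (α := Fin 2) n
    rw [Fintype.card_fin] at h2
    rw [← h2]
    exact Fintype.card_congr (Equiv.refl _)
  rw [tsum_fintype, Finset.sum_const, Finset.card_univ, nsmul_eq_mul, hcard]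
  push_cast
  rfl

theorem tsum_vertex_depth (f : ℕ → ℝ≥0∞) :
    ∑' x : Vertex, f (depth x) = f 0 + 3 * ∑' n, 2 ^ n * f (n + 1) := by
  have hs : HasSum ((fun x : Vertex => f (depth x)) ∘ (Equiv.optionEquivSumPUnit _).symm)
      ((∑' a : Fin 3 × List (Fin 2), f (depth (some a))) + ∑' _ : PUnit.{1}, f (depth none)) :=
    HasSum.sum ENNReal.summable.hasSum ENNReal.summable.hasSum
  rw [((Equiv.optionEquivSumPUnit _).symm.hasSum_iff.1 hs).tsum_eq, ENNReal.tsum_prod', add_comm]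
  simp only [depth, tsum_list_length fun n => f (n + 1)]
  rw [tsum_fintype, tsum_fintype]
  simp

theorem levelRatio_mul_two_lt_one {β : ℝ} (hβ : 2 < β) : (levelRatio β : ℝ≥0∞) * 2 < 1 := by
  have h : levelRatio β * 2 < 1 := by
    rw [levelRatio]
    nth_rw 2 [← NNReal.rpow_one 2]
    rw [← NNReal.rpow_add (by norm_num)]
    exact NNReal.rpow_lt_one_of_one_lt_of_neg (by norm_num) (by linarith)
  exact_mod_cast h

theorem exists_roadRate_eq {β : ℝ} (hβ : 2 < β) {ε : ℝ≥0} (hε : 0 < ε) :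
    ∃ t : ℝ, 0 < t ∧ roadRate β t = ε := by
  have h18 : (0 : ℝ≥0) < ε / 18 := by positivity
  refine ⟨1 / (2 * ((ε / 18 : ℝ≥0) : ℝ) ^ (1 / (1 - β))), ?_, ?_⟩
  · have : (0 : ℝ) < (ε / 18 : ℝ≥0) := h18
    positivity
  · have h1 : 1 / (2 * (1 / (2 * ((ε / 18 : ℝ≥0) : ℝ) ^ (1 / (1 - β))))) =
        (((ε / 18 : ℝ≥0) ^ (1 / (1 - β)) : ℝ≥0) : ℝ) := by
      rw [NNReal.coe_rpow]
      field_simp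
    rw [roadRate, h1, Real.toNNReal_coe, ← NNReal.rpow_mul,
      one_div_mul_cancel (by linarith), NNReal.rpow_one]
    exact mul_div_cancel₀ _ (by norm_num)

theorem exists_time {β : ℝ} (hβ : 2 < β) : ∃ t : ℝ, 0 < t ∧ (roadRate β t : ℝ) ≤ 1 / 128 ∧
    ∑' m, renewal (coverWeight (roadRate β t) (levelRatio β)) (m + 1) ≤ 1 / 2 := by
  obtain ⟨K, hK⟩ : ∃ K : ℝ≥0, weightConst (levelRatio β) = K :=
    ⟨_, (ENNReal.coe_toNNReal (weightConst_ne_top (levelRatio_mul_two_lt_one hβ))).symm⟩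
  -- This rate makes the Chernoff bound applicable and the total renewal weight at most `1 / 4`;
  -- then `1 / 4 * (1 + 1 / 2) ≤ 1 / 2` bounds the renewal sum.
  obtain ⟨t, ht, hε⟩ := exists_roadRate_eq hβ (ε := 1 / (128 * (K + 1))) (by positivity)
  refine ⟨t, ht, ?_, tsum_renewal_le (W := ((1 / 4 : ℝ≥0) : ℝ≥0∞)) ?_ ?_⟩
  · rw [hε]
    have : (1 / (128 * (K + 1)) : ℝ≥0) ≤ 1 / 128 := by
      apply one_div_le_one_div_of_le (by norm_num)
      exact le_mul_of_one_le_right' le_add_self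
    exact_mod_cast this
  · refine (tsum_coverWeight_le _ _).trans ?_
    rw [hε, hK, ← ENNReal.coe_mul]
    refine ENNReal.coe_le_coe.2 ?_
    rw [one_div_mul_eq_div, div_le_div_iff₀ (by positivity) (by norm_num)]
    calc K * 4 ≤ (K + 1) * 128 := mul_le_mul' le_self_add (by norm_num)
      _ = 1 * (128 * (K + 1)) := by ring
  · have : (1 / 4 : ℝ≥0) * (1 + 1 / 2) ≤ 1 / 2 := by
      rw [← NNReal.coe_le_coe]
      push_cast
      norm_num
    have h2 : ((1 / 2 : ℝ≥0) : ℝ≥0∞) = 1 / 2 := by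
      rw [ENNReal.coe_div (by norm_num)]
      simp
    rw [← h2]
    exact_mod_cast this

/-! ## The number of vertices that are reached, and the absence of explosion -/

section Ball

variable {Ω : Type*} [MeasurableSpace Ω] {P : Measure Ω}
  {N : Ω → Measure Road} {β : ℝ}

theorem IsPoissonProcess.measurable_descentTime {ν : Measure Road} (hN : IsPoissonProcess P ν N)
    (d : ℕ) (x : Vertex) : Measurable fun ω => descentTime (N ω) d x := by
  simp only [descentTime, pathTime]
  exact Finset.measurable_sum _ fun i _ =>
    (measurable_speed hN.measurable hN.atomic (ancestor d x i) (ancestor d x (i + 1))).inv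

theorem encard_drivingBall (π : Measure Road) (t : ℝ) :
    ((drivingBall π t).encard : ℝ≥0∞) =
      ∑' x, {x | descentTime π 0 x ≤ ENNReal.ofReal t}.indicator (fun _ => (1 : ℝ≥0∞)) x := by
  rw [← ENNReal.tsum_set_one, tsum_subtype (drivingBall π t) fun _ => (1 : ℝ≥0∞)]
  simp only [drivingBall, drivingDist_root]

theorem measurable_encard_drivingBall {ν : Measure Road} (hN : IsPoissonProcess P ν N) (t : ℝ) :
    Measurable (fun ω => ((drivingBall (N ω) t).encard : ℝ≥0∞)) := by
  simp only [encard_drivingBall]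
  refine Measurable.tsum fun x => ?_
  exact measurable_const.indicator (f := fun _ : Ω => (1 : ℝ≥0∞))
    (measurableSet_le (hN.measurable_descentTime 0 x) measurable_const)

variable [IsProbabilityMeasure P]

theorem measure_descentTime_le (hN : IsPoissonProcess P (roadIntensity β) N) (hβ : 2 < β) {t : ℝ}
    (ht : 0 < t) (hδ : (roadRate β t : ℝ) ≤ 1 / 128) (d : ℕ) (x : Vertex) :
    P {ω | d ≤ depth x ∧ descentTime (N ω) d x ≤ ENNReal.ofReal t} ≤
      if d ≤ depth x then 2⁻¹ ^ (depth x - d) *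
        renewal (coverWeight (roadRate β t) (levelRatio β)) (depth x - d) else 0 := by
  split_ifs with h
  · exact (measure_mono fun ω hω => hω.2).trans
      (measure_pathTime_le hN hβ ht hδ fun i hi => depth_ancestor h hi)
  · simp [h]

theorem two_pow_mul_inv_two_pow (n : ℕ) : (2 : ℝ≥0∞) ^ n * 2⁻¹ ^ n = 1 := by
  rw [← mul_pow, ENNReal.mul_inv_cancel (by norm_num) (by norm_num), one_pow]

/-- This is the input to Borel–Cantelli. At depth `d + m` the number of vertices, of order `2 ^ (d +
m)`, cancels the factor `2⁻¹ ^ m` up to `2 ^ d`, which leaves the summable renewal sequence. -/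
theorem tsum_measure_descentTime_ne_top (hN : IsPoissonProcess P (roadIntensity β) N) (hβ : 2 < β)
    {t : ℝ} (ht : 0 < t) (hδ : (roadRate β t : ℝ) ≤ 1 / 128)
    (hu : ∑' m, renewal (coverWeight (roadRate β t) (levelRatio β)) (m + 1) ≤ 1 / 2) (d : ℕ) :
    ∑' x, P {ω | d ≤ depth x ∧ descentTime (N ω) d x ≤ ENNReal.ofReal t} ≠ ∞ := by
  set u := renewal (coverWeight (roadRate β t) (levelRatio β)) with hudef
  let g : ℕ → ℝ≥0∞ := fun n => if d ≤ n then 2⁻¹ ^ (n - d) * u (n - d) else 0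
  have hsum : ∑' m, u m ≤ 1 + 1 / 2 := by
    rw [tsum_eq_zero_add' ENNReal.summable]
    exact add_le_add (by rw [hudef, renewal]) hu
  have hg : ∑' n, 2 ^ n * g n = 2 ^ d * ∑' m, u m := by
    rw [← ENNReal.summable.sum_add_tsum_nat_add' (k := d), Finset.sum_eq_zero, zero_add,
      ← ENNReal.tsum_mul_left]
    · refine tsum_congr fun m => ?_
      simp only [g, if_pos (Nat.le_add_left d m), Nat.add_sub_cancel]
      rw [pow_add, mul_mul_mul_comm, two_pow_mul_inv_two_pow, one_mul]
    · intro n hn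
      rw [Finset.mem_range] at hn
      simp [g, hn.not_ge]
  have hle : ∑' x, P {ω | d ≤ depth x ∧ descentTime (N ω) d x ≤ ENNReal.ofReal t} ≤
      g 0 + 3 * ∑' n, 2 ^ (n + 1) * g (n + 1) := by
    refine (ENNReal.tsum_le_tsum fun x => measure_descentTime_le hN hβ ht hδ d x).trans ?_
    refine (tsum_vertex_depth g).trans_le ?_
    gcongr
    · norm_num
    · omega
  have hle' : g 0 + 3 * ∑' n, 2 ^ (n + 1) * g (n + 1) ≤ 3 * (2 ^ d * (1 + 1 / 2)) := by
    refine le_trans ?_ (mul_le_mul_right (mul_le_mul_right hsum _) _)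
    rw [← hg, tsum_eq_zero_add' (f := fun n => 2 ^ n * g n) ENNReal.summable, mul_add, pow_zero,
      one_mul]
    exact add_le_add_left (le_mul_of_one_le_left' (by norm_num)) _
  refine ((hle.trans hle').trans_lt ?_).ne
  refine ENNReal.mul_lt_top (by norm_num) (ENNReal.mul_lt_top ?_ ?_)
  · exact ENNReal.pow_lt_top (by norm_num)
  · exact ENNReal.add_lt_top.2 ⟨by norm_num, ENNReal.div_lt_top (by norm_num) (by norm_num)⟩

theorem lintegral_encard_drivingBall_le (hN : IsPoissonProcess P (roadIntensity β) N) (hβ : 2 < β)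
    {t : ℝ} (ht : 0 < t) (hδ : (roadRate β t : ℝ) ≤ 1 / 128)
    (hu : ∑' m, renewal (coverWeight (roadRate β t) (levelRatio β)) (m + 1) ≤ 1 / 2) :
    ∫⁻ ω, ((drivingBall (N ω) t).encard : ℝ≥0∞) ∂P ≤ 2 := by
  set u := renewal (coverWeight (roadRate β t) (levelRatio β)) with hudef
  have hm : ∀ x, MeasurableSet {ω | descentTime (N ω) 0 x ≤ ENNReal.ofReal t} := fun x =>
    measurableSet_le (hN.measurable_descentTime 0 x) measurable_const
  have h1 : ∫⁻ ω, ((drivingBall (N ω) t).encard : ℝ≥0∞) ∂P =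
      ∑' x, P {ω | descentTime (N ω) 0 x ≤ ENNReal.ofReal t} := by
    simp only [encard_drivingBall]
    refine (lintegral_tsum fun x => (measurable_const.indicator (f := fun _ : Ω => (1 : ℝ≥0∞))
      (hm x)).aemeasurable).trans (tsum_congr fun x => lintegral_indicator_one (hm x))
  rw [h1]
  have h2 : ∀ x : Vertex, P {ω | descentTime (N ω) 0 x ≤ ENNReal.ofReal t} ≤
      2⁻¹ ^ depth x * u (depth x) := by
    intro x
    have := measure_descentTime_le hN hβ ht hδ 0 x
    simpa using this
  refine (ENNReal.tsum_le_tsum h2).trans ?_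
  -- The root contributes `1`, and the `3 * 2 ^ n` vertices at depth `n + 1` contribute `3 / 2 * u
  -- (n + 1)`, so the total is at most `1 + 3 / 4`.
  rw [tsum_vertex_depth fun n => 2⁻¹ ^ n * u n]
  have h3 : ∀ n, (2 : ℝ≥0∞) ^ n * (2⁻¹ ^ (n + 1) * u (n + 1)) = 2⁻¹ * u (n + 1) := by
    intro n
    rw [pow_succ, ← mul_assoc, ← mul_assoc, two_pow_mul_inv_two_pow, one_mul]
  simp only [h3]
  rw [ENNReal.tsum_mul_left, hudef, renewal, pow_zero, mul_one]
  calc 1 + 3 * (2⁻¹ * ∑' m, u (m + 1)) ≤ 1 + 3 * (2⁻¹ * (1 / 2)) := by gcongr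
    _ ≤ 1 + 4 * (2⁻¹ * 2⁻¹) := by
      rw [one_div]
      gcongr
      norm_num
    _ = 2 := by
      rw [show (4 : ℝ≥0∞) * (2⁻¹ * 2⁻¹) = (2 * 2⁻¹) * (2 * 2⁻¹) by ring,
        ENNReal.mul_inv_cancel (by norm_num) (by norm_num)]
      norm_num

theorem ae_tsum_drivingDist_eq_top (hN : IsPoissonProcess P (roadIntensity β) N) (hβ : 2 < β)
    {t : ℝ} (ht : 0 < t) (hδ : (roadRate β t : ℝ) ≤ 1 / 128)
    (hu : ∑' m, renewal (coverWeight (roadRate β t) (levelRatio β)) (m + 1) ≤ 1 / 2) :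
    ∀ᵐ ω ∂P, ∀ x : ℕ → Vertex, IsGeodesicRay x →
      ∑' n : ℕ, drivingDist (N ω) (x n) (x (n + 1)) = ∞ := by
  have hfin : ∀ᵐ ω ∂P, ∀ d : ℕ,
      {x | d ≤ depth x ∧ descentTime (N ω) d x ≤ ENNReal.ofReal t}.Finite :=
    ae_all_iff.2 fun d =>
      ae_finite_setOfPred_mem (tsum_measure_descentTime_ne_top hN hβ ht hδ hu d)
  filter_upwards [hfin] with ω hω x hx
  by_contra hne
  -- A convergent series has a tail below `t`; every vertex of the ray beyond depth `d` then belongs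
  -- to the set that is almost surely finite.
  obtain ⟨d, hd⟩ := ((ENNReal.tendsto_sum_nat_add
    (fun n => drivingDist (N ω) (x n) (x (n + 1))) hne).eventually
    (gt_mem_nhds (ENNReal.ofReal_pos.2 ht))).exists
  have hinj : Function.Injective fun m => x (d + m) := by
    intro m m' h
    have := congrArg depth h
    simp only [hx.depth_eq] at this
    omega
  refine Set.infinite_of_injective_forall_mem hinj (fun m => ?_) (hω d)
  refine ⟨by rw [hx.depth_eq]; omega, ?_⟩
  rw [hx.descentTime_eq]
  exact (ENNReal.sum_le_tsum _).trans hd.le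

end Ball

end TreeRoads

open TreeRoads
theorem proposition3 (β : ℝ) (hβ : 2 < β) :
    ∃ t : ℝ, 0 < t ∧
      ∀ (Ω : Type*) [MeasurableSpace Ω] (P : Measure Ω) [IsProbabilityMeasure P]
        (N : Ω → Measure Road), IsPoissonProcess P (roadIntensity β) N →
        Measurable (fun ω => ((drivingBall (N ω) t).encard : ℝ≥0∞)) ∧
        ∫⁻ ω, ((drivingBall (N ω) t).encard : ℝ≥0∞) ∂P ≤ 2 ∧
        (∀ᵐ ω ∂P, ∀ x : ℕ → Vertex, IsGeodesicRay x →
          ∑' n : ℕ, drivingDist (N ω) (x n) (x (n + 1)) = ∞) := by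
  obtain ⟨t, ht, hδ, hu⟩ := exists_time hβ
  exact ⟨t, ht, fun Ω _ P _ N hN => ⟨measurable_encard_drivingBall hN t,
    lintegral_encard_drivingBall_le hN hβ ht hδ hu, ae_tsum_drivingDist_eq_top hN hβ ht hδ hu⟩⟩
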